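/- Let $d\ge 0$ be an integer and let $G$ be a (finite or infinite) simple graph in which every vertex has at most $d$ neighbours. For a vertex $o$ of $G$, let $T(G,o)$ be the path tree: its vertices are the finite (self-avoiding) paths of $G$ starting at $o$, two of them being adjacent if one is obtained from the other by adding one edge at its end. Let $A_o$ be the adjacency operator of $T(G,o)$ on $\ell^2(V(T(G,o)))$, let $\chi_o$ be the characteristic vector of the one-vertex path $o$, and let the matching measure $\nu_{G,o}$ be the unique probability measure on $[-d,d]$ with $\int x^n\,d\nu_{G,o}(x)=\langle A_o^n\chi_o,\chi_o\rangle$ for all integers $n\ge 0$. Fix $\theta\in\mathbb{R}$. A vertex $u$ is called $\theta$-essential in $G$ if $\nu_{G,u}(\{\theta\})>0$, and a graph is called $\theta$-critical if all its vertices are $\theta$-essential in it. Let $D$ be the set of $\theta$-essential vertices of $G$, and let $A=\partial D$ be the set of vertices that are not in $D$ but have a neighbour in $D$. Then: (a) every connected component of the induced subgraph $G[D]$ is $\theta$-critical; (b) for every finite nonempty subset $X\subseteq A$, there are at least $|X|+1$ connected components of $G[D]$ that contain a neighbour (in $G$) of some vertex of $X$. -/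

import Mathlib

open scoped InnerProductSpace ENNReal CompactlySupported
open MeasureTheory

namespace MatchingMeasure

universe u

/-- Every vertex of the graph `G` has at most `d` neighbours. -/
class DegreeAtMost {V : Type u} (G : SimpleGraph V) (d : ℕ) : Prop where
  encard_le : ∀ v, (G.neighborSet v).encard ≤ d

theorem finite_neighborSet {V : Type u} (G : SimpleGraph V) (d : ℕ) [DegreeAtMost G d] (v : V) : (G.neighborSet v).Finite :=
  Set.finite_of_encard_le_coe (DegreeAtMost.encard_le (d := d) v)

section Adjacency

variable {V : Type u} (G : SimpleGraph V) (d : ℕ) [DegreeAtMost G d]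

/-- The finite set of neighbours of `v`. -/
noncomputable def nbrs (v : V) : Finset V := (finite_neighborSet G d v).toFinset

variable {G} in
@[simp] theorem mem_nbrs {v w : V} : w ∈ nbrs G d v ↔ G.Adj v w := by
  simp [nbrs]

theorem card_nbrs_le (v : V) : (nbrs G d v).card ≤ d := by
  have h := DegreeAtMost.encard_le (G := G) (d := d) v
  rw [(finite_neighborSet G d v).encard_eq_coe_toFinset_card] at h
  exact_mod_cast h

theorem sum_nbrs_le (f : lp (fun _ : V => ℂ) 2) (s : Finset V) :
    ∑ v ∈ s, ‖∑ w ∈ nbrs G d v, f w‖ ^ (2 : ℝ≥0∞).toReal ≤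
      ((d : ℝ) * ‖f‖) ^ (2 : ℝ≥0∞).toReal := by
  classical
  simp only [ENNReal.toReal_ofNat, Real.rpow_ofNat]
  have h1 : ∀ v, ‖∑ w ∈ nbrs G d v, f w‖ ^ 2 ≤ d * ∑ w ∈ nbrs G d v, ‖f w‖ ^ 2 := by
    intro v
    calc ‖∑ w ∈ nbrs G d v, f w‖ ^ 2 ≤ (∑ w ∈ nbrs G d v, ‖f w‖) ^ 2 := by
          gcongr; exact norm_sum_le _ _
      _ ≤ (nbrs G d v).card * ∑ w ∈ nbrs G d v, ‖f w‖ ^ 2 := sq_sum_le_card_mul_sum_sq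
      _ ≤ d * ∑ w ∈ nbrs G d v, ‖f w‖ ^ 2 := by
          gcongr
          exact card_nbrs_le G d v
  have h2 : ∑ v ∈ s, ∑ w ∈ nbrs G d v, ‖f w‖ ^ 2 ≤
      ∑ w ∈ s.biUnion (nbrs G d), d * ‖f w‖ ^ 2 := by
    rw [Finset.sum_comm' (t' := s.biUnion (nbrs G d)) (s' := fun w => s ∩ nbrs G d w)]
    · refine Finset.sum_le_sum fun w _ => ?_
      rw [Finset.sum_const, nsmul_eq_mul]
      gcongr
      exact (Finset.card_le_card Finset.inter_subset_right).trans (card_nbrs_le G d w)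
    · intro v w
      simp only [mem_nbrs, Finset.mem_inter, Finset.mem_biUnion, G.adj_comm w v]
      constructor
      · rintro ⟨a, b⟩; exact ⟨⟨a, b⟩, v, a, b⟩
      · rintro ⟨a, -⟩; exact a
  have h3 : ∑ w ∈ s.biUnion (nbrs G d), ‖f w‖ ^ 2 ≤ ‖f‖ ^ 2 := by
    have := lp.sum_rpow_le_norm_rpow (p := 2) (by simp) f (s.biUnion (nbrs G d))
    simpa using this
  calc ∑ v ∈ s, ‖∑ w ∈ nbrs G d v, f w‖ ^ 2
      ≤ ∑ v ∈ s, d * ∑ w ∈ nbrs G d v, ‖f w‖ ^ 2 := Finset.sum_le_sum fun v _ => h1 v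
    _ = d * ∑ v ∈ s, ∑ w ∈ nbrs G d v, ‖f w‖ ^ 2 := by rw [Finset.mul_sum]
    _ ≤ d * (d * ‖f‖ ^ 2) := by
        rw [← Finset.mul_sum] at h2
        have := mul_le_mul_of_nonneg_left h3 (Nat.cast_nonneg (α := ℝ) d)
        gcongr
        linarith
    _ = (d * ‖f‖) ^ 2 := by ring

/-- The adjacency operator `(A f) v = ∑_{w ∼ v} f w` on the Hilbert space `ℓ²(V)`. -/
noncomputable def adjacencyOperator :
    lp (fun _ : V => ℂ) 2 →L[ℂ] lp (fun _ : V => ℂ) 2 :=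
  LinearMap.mkContinuous
    { toFun := fun f => ⟨fun v => ∑ w ∈ nbrs G d v, f w, memℓp_gen' (sum_nbrs_le G d f)⟩
      map_add' := fun f g => by
        ext v; exact Finset.sum_add_distrib
      map_smul' := fun c f => by
        ext v; exact (Finset.mul_sum _ _ _).symm }
    d (fun f => lp.norm_le_of_forall_sum_le (by simp) (by positivity) (sum_nbrs_le G d f))

theorem adjacencyOperator_apply (f : lp (fun _ : V => ℂ) 2) (v : V) :
    adjacencyOperator G d f v = ∑ w ∈ nbrs G d v, f w := rfl

theorem norm_adjacencyOperator_le : ‖adjacencyOperator G d‖ ≤ d :=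
  LinearMap.mkContinuous_norm_le _ (by positivity) _

/-- The characteristic vector of the vertex `v`. -/
noncomputable def chi (v : V) : lp (fun _ : V => ℂ) 2 :=
  open Classical in lp.single 2 v (1 : ℂ)

theorem norm_chi (v : V) : ‖chi v‖ = 1 := by
  classical
  simp [chi, lp.norm_single]

theorem inner_chi (v : V) (f : lp (fun _ : V => ℂ) 2) : ⟪chi v, f⟫_ℂ = f v := by
  classical
  simp [chi, lp.inner_single_left]

theorem adjacencyOperator_chi (v : V) :
    adjacencyOperator G d (chi v) = ∑ w ∈ nbrs G d v, chi w := by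
  classical
  ext u
  rw [adjacencyOperator_apply, lp.coeFn_sum, Finset.sum_apply]
  simp only [chi, lp.coeFn_single, Pi.single_apply]
  simp [Finset.sum_ite_eq, G.adj_comm]

theorem isSelfAdjoint_adjacencyOperator : IsSelfAdjoint (adjacencyOperator G d) := by
  rw [ContinuousLinearMap.isSelfAdjoint_iff']
  ext g v
  rw [← inner_chi, ContinuousLinearMap.adjoint_inner_right, adjacencyOperator_chi, sum_inner,
    adjacencyOperator_apply]
  simp [inner_chi]

end Adjacency

section Spectral

variable {H : Type*} [NormedAddCommGroup H] [InnerProductSpace ℂ H]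

/-- `μ` is a probability measure on `[-d, d]` whose moments are `⟨Aⁿ x, x⟩`. -/
structure IsSpectralMeasure (A : H →L[ℂ] H) (x : H) (d : ℕ) (μ : Measure ℝ) : Prop where
  isProbabilityMeasure : IsProbabilityMeasure μ
  support : μ (Set.Icc (-(d : ℝ)) d)ᶜ = 0
  moment : ∀ n : ℕ, ((∫ t, t ^ n ∂μ : ℝ) : ℂ) = ⟪x, (A ^ n) x⟫_ℂ

theorem integrable_of_continuous {d : ℕ} {μ : Measure ℝ} [IsProbabilityMeasure μ]
    (hs : μ (Set.Icc (-(d : ℝ)) d)ᶜ = 0) {f : ℝ → ℝ} (hf : Continuous f) : Integrable f μ := by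
  have h : μ.restrict (Set.Icc (-(d : ℝ)) d) = μ :=
    Measure.restrict_eq_self_of_ae_mem (by rw [ae_iff]; exact hs)
  rw [← h]
  exact hf.continuousOn.integrableOn_compact isCompact_Icc

theorem IsSpectralMeasure.unique {A : H →L[ℂ] H} {x : H} {d : ℕ} {μ ν : Measure ℝ}
    (hμ : IsSpectralMeasure A x d μ) (hν : IsSpectralMeasure A x d ν) : μ = ν := by
  have := hμ.isProbabilityMeasure
  have := hν.isProbabilityMeasure
  have hpow : ∀ n : ℕ, ∫ t, t ^ n ∂μ = ∫ t, t ^ n ∂ν := by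
    intro n
    have := (hμ.moment n).trans (hν.moment n).symm
    exact_mod_cast this
  have hpoly : ∀ p : Polynomial ℝ, ∫ t, p.eval t ∂μ = ∫ t, p.eval t ∂ν := by
    intro p
    simp only [Polynomial.eval_eq_sum_range]
    rw [integral_finsetSum, integral_finsetSum]
    · simp only [integral_const_mul, hpow]
    · intro i _
      exact integrable_of_continuous hν.support (by fun_prop)
    · intro i _
      exact integrable_of_continuous hμ.support (by fun_prop)
  refine ext_of_forall_integral_eq_of_IsFiniteMeasure fun f => ?_
  refine eq_of_forall_dist_le fun ε hε => ?_
  obtain ⟨p, hp⟩ := exists_polynomial_near_of_continuousOn (-(d : ℝ)) d f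
    f.continuous.continuousOn (ε / 2) (by positivity)
  have key : ∀ ρ : Measure ℝ, IsProbabilityMeasure ρ → ρ (Set.Icc (-(d : ℝ)) d)ᶜ = 0 →
      ‖∫ t, p.eval t ∂ρ - ∫ t, f t ∂ρ‖ ≤ ε / 2 := by
    intro ρ _ hs
    rw [← integral_sub (integrable_of_continuous hs (by fun_prop))
      (integrable_of_continuous hs f.continuous)]
    have := norm_integral_le_of_norm_le_const (μ := ρ) (f := fun t => p.eval t - f t)
      (C := ε / 2) (by
        have : ∀ᵐ t ∂ρ, t ∈ Set.Icc (-(d : ℝ)) d := by rw [ae_iff]; exact hs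
        filter_upwards [this] with t ht
        exact (hp t ht).le)
    simpa using this
  have k1 := key μ inferInstance hμ.support
  have k2 := key ν inferInstance hν.support
  rw [hpoly p] at k1
  rw [Real.norm_eq_abs] at k1 k2
  rw [Real.dist_eq]
  rw [abs_le] at *
  constructor <;> linarith [k1.1, k1.2, k2.1, k2.2]

theorem exists_isSpectralMeasure [CompleteSpace H] {A : H →L[ℂ] H} (hA : IsSelfAdjoint A) {x : H}
    (hx : ‖x‖ = 1) {d : ℕ} (hd : ‖A‖ ≤ d) : ∃ μ, IsSpectralMeasure A x d μ := by
  classical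
  let S := spectrum ℝ A
  let L : C(S, ℝ) →ₗ[ℝ] ℝ :=
    { toFun := fun f => (⟪x, cfcHom (R := ℝ) hA f x⟫_ℂ).re
      map_add' := fun f g => by simp
      map_smul' := fun c f => by
        simp [inner_smul_right_eq_smul] }
  have him : ∀ f : C(S, ℝ), ((L f : ℝ) : ℂ) = ⟪x, cfcHom (R := ℝ) hA f x⟫_ℂ := by
    intro f
    have hsa : IsSelfAdjoint (cfcHom (R := ℝ) hA f) := cfcHom_predicate hA f
    have h1 := hsa.isSymmetric.coe_re_inner_self_apply x
    exact h1
  have hpos : ∀ f : C(S, ℝ), 0 ≤ f → 0 ≤ L f := by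
    intro f hf
    have h1 : (0 : H →L[ℂ] H) ≤ cfcHom (R := ℝ) hA f := by
      have := cfcHom_mono hA hf
      simpa using this
    have h2 := (ContinuousLinearMap.nonneg_iff_isPositive _).mp h1
    exact h2.re_inner_nonneg_right x
  let Λ : C_c(S, ℝ) →ₚ[ℝ] ℝ := PositiveLinearMap.mk₀
    { toFun := fun f => L f.toContinuousMap
      map_add' := fun f g => L.map_add _ _
      map_smul' := fun c f => L.map_smul c _ } (fun f hf => hpos _ hf)
  let ρ : Measure S := RealRMK.rieszMeasure Λ
  have hint : ∀ f : C(S, ℝ), ∫ t, f t ∂ρ = L f := by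
    intro f
    exact RealRMK.integral_rieszMeasure Λ (CompactlySupportedContinuousMap.continuousMapEquiv f)
  have hmom : ∀ n : ℕ, ((∫ t : S, (t : ℝ) ^ n ∂ρ : ℝ) : ℂ) = ⟪x, (A ^ n) x⟫_ℂ := by
    intro n
    have h1 := hint ((ContinuousMap.restrict S (ContinuousMap.id ℝ)) ^ n)
    have h2 := him ((ContinuousMap.restrict S (ContinuousMap.id ℝ)) ^ n)
    rw [map_pow (cfcHom (R := ℝ) hA), cfcHom_id hA] at h2
    rw [← h2, ← h1]
    rfl
  have hfin : IsFiniteMeasure ρ := by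
    refine ⟨?_⟩
    exact isCompact_univ.measure_lt_top
  have hprob : IsProbabilityMeasure ρ := by
    have h := hmom 0
    simp only [pow_zero, integral_const, smul_eq_mul, mul_one, one_apply_eq_self,
      inner_self_eq_norm_sq_to_K, hx] at h
    refine ⟨?_⟩
    have h' : ρ.real Set.univ = 1 := by
      norm_num at h
      exact_mod_cast h
    rwa [measureReal_def, ENNReal.toReal_eq_one_iff] at h'
  have hemb : MeasurableEmbedding (Subtype.val : S → ℝ) :=
    MeasurableEmbedding.subtype_coe (spectrum.isClosed A).measurableSet
  refine ⟨ρ.map Subtype.val, Measure.isProbabilityMeasure_map hemb.measurable.aemeasurable, ?_, ?_⟩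
  · rw [hemb.map_apply]
    convert measure_empty (μ := ρ)
    ext t
    simp only [Set.mem_preimage, Set.mem_compl_iff, Set.mem_empty_iff_false, iff_false, not_not]
    have h1 : ‖(t : ℝ)‖ ≤ ‖A‖ * ‖(1 : H →L[ℂ] H)‖ := spectrum.norm_le_norm_mul_of_mem t.2
    have h2 : ‖(1 : H →L[ℂ] H)‖ ≤ 1 := ContinuousLinearMap.norm_id_le
    have h3 : |(t : ℝ)| ≤ d := by
      rw [← Real.norm_eq_abs]
      nlinarith [norm_nonneg A]
    exact abs_le.mp h3
  · intro n
    rw [hemb.integral_map, hmom n]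

end Spectral

section PathTree

variable {V : Type u} (G : SimpleGraph V)

/-- The finite paths in `G` starting at `o`. -/
def PathsFrom (o : V) : Type u := Σ v : V, G.Path o v

variable {G} in
/-- The path `Q` is obtained from the path `P` by adding one edge at its end; that is, `P` is a
maximal proper subpath of `Q`. -/
def IsOneStepExtension {o : V} (P Q : PathsFrom G o) : Prop :=
  ∃ h : G.Adj P.1 Q.1, (Q.2 : G.Walk o Q.1) = (P.2 : G.Walk o P.1).concat h

/-- The path tree of `G` relative to `o`: its vertices are the finite paths starting at `o`, two
being adjacent if one is a maximal proper subpath of the other. -/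
def pathTree (o : V) : SimpleGraph (PathsFrom G o) where
  Adj P Q := IsOneStepExtension P Q ∨ IsOneStepExtension Q P
  symm := ⟨fun _ _ h => h.symm⟩
  loopless := ⟨fun P h => by
    have h' : IsOneStepExtension P P := by tauto
    exact h'.1.ne rfl⟩

/-- The one-vertex path. -/
def trivialPath (o : V) : PathsFrom G o := ⟨o, SimpleGraph.Path.nil⟩

variable {G} in
theorem IsOneStepExtension.notMem {o : V} {P Q : PathsFrom G o} (h : IsOneStepExtension P Q) :
    Q.1 ∉ (P.2 : G.Walk o P.1).support := by
  obtain ⟨h, e⟩ := h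
  have := Q.2.2
  rw [e, SimpleGraph.Walk.concat_isPath_iff] at this
  exact this.2

variable {G} in
theorem IsOneStepExtension.mem {o : V} {P Q : PathsFrom G o} (h : IsOneStepExtension P Q) :
    P.1 ∈ (Q.2 : G.Walk o Q.1).support := by
  obtain ⟨h, e⟩ := h
  rw [e, SimpleGraph.Walk.support_concat]
  simp

variable {G} in
theorem pathTree_injOn {o : V} (P : PathsFrom G o) :
    Set.InjOn (fun Q : PathsFrom G o => Q.1) ((pathTree G o).neighborSet P) := by
  rintro ⟨a, Q, hQ⟩ h1 ⟨b, R, hR⟩ h2 hab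
  change a = b at hab
  subst hab
  rcases h1 with h1 | h1 <;> rcases h2 with h2 | h2
  · obtain ⟨_, e1⟩ := h1
    obtain ⟨_, e2⟩ := h2
    exact Sigma.ext rfl (heq_of_eq (Subtype.ext (e1.trans e2.symm)))
  · exact absurd h2.mem h1.notMem
  · exact absurd h1.mem h2.notMem
  · obtain ⟨_, e1⟩ := h1
    obtain ⟨_, e2⟩ := h2
    have e := SimpleGraph.Walk.concat_inj (e1.symm.trans e2)
    obtain ⟨p, r⟩ := P
    exact Sigma.ext rfl (heq_of_eq (Subtype.ext (by simpa using e)))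

instance pathTree.degreeAtMost (d : ℕ) [DegreeAtMost G d] (o : V) :
    DegreeAtMost (pathTree G o) d where
  encard_le P := by
    refine le_trans ?_ (DegreeAtMost.encard_le (G := G) (d := d) P.1)
    rw [← (pathTree_injOn P).encard_image]
    refine Set.encard_le_encard ?_
    rintro _ ⟨Q, h | h, rfl⟩
    · exact h.1
    · exact h.1.symm

instance induce.degreeAtMost (d : ℕ) [DegreeAtMost G d] (S : Set V) :
    DegreeAtMost (G.induce S) d where
  encard_le v := by
    refine le_trans ?_ (DegreeAtMost.encard_le (G := G) (d := d) v.1)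
    rw [← Subtype.val_injective.encard_image]
    refine Set.encard_le_encard ?_
    rintro _ ⟨w, h, rfl⟩
    exact h

instance toSimpleGraph.degreeAtMost (d : ℕ) [DegreeAtMost G d] (c : G.ConnectedComponent) :
    DegreeAtMost c.toSimpleGraph d :=
  induce.degreeAtMost G d c.supp

end PathTree

section Main

variable {V : Type u} (G : SimpleGraph V) (d : ℕ) [DegreeAtMost G d]

/-- `μ` is a probability measure on `[-d, d]` such that `∫ tⁿ dμ = ⟨Aⁿ χ, χ⟩` for all `n`, where
`A` is the adjacency operator of the path tree of `G` relative to `o` and `χ` is the characteristic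
vector of the one-vertex path `o`. -/
def IsMatchingMeasure (o : V) (μ : Measure ℝ) : Prop :=
  IsSpectralMeasure (adjacencyOperator (pathTree G o) d) (chi (trivialPath G o)) d μ

theorem existsUnique_isMatchingMeasure (o : V) : ∃! μ, IsMatchingMeasure G d o μ := by
  obtain ⟨μ, hμ⟩ := exists_isSpectralMeasure
    (isSelfAdjoint_adjacencyOperator (pathTree G o) d) (norm_chi (trivialPath G o))
    (norm_adjacencyOperator_le (pathTree G o) d)
  exact ⟨μ, hμ, fun ν hν => IsSpectralMeasure.unique hν hμ⟩

/-- The matching measure of the graph `G`, whose degrees are at most `d`, with root `o`. -/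
noncomputable def matchingMeasure (o : V) : Measure ℝ :=
  (existsUnique_isMatchingMeasure G d o).choose

theorem isMatchingMeasure_matchingMeasure (o : V) :
    IsMatchingMeasure G d o (matchingMeasure G d o) :=
  (existsUnique_isMatchingMeasure G d o).choose_spec.1

/-- The vertex `u` is `θ`-essential in `G`. -/
def IsEssential (θ : ℝ) (u : V) : Prop := 0 < matchingMeasure G d u {θ}

/-- The set of `θ`-essential vertices of `G`. -/
def essentialSet (θ : ℝ) : Set V := {u | IsEssential G d θ u}

/-- All vertices of `G` are `θ`-essential. -/
def IsCritical (θ : ℝ) : Prop := ∀ u, IsEssential G d θ u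

end Main

section Boundary

variable {V : Type u} (G : SimpleGraph V)

/-- The outer vertex boundary of `S`. -/
def outerBoundary (S : Set V) : Set V := {v | v ∉ S ∧ ∃ w ∈ S, G.Adj v w}

/-- The connected components of the induced subgraph `G[S]` that contain a neighbour in `G` of
some vertex of `X`. -/
def adjacentComponents (S X : Set V) : Set (G.induce S).ConnectedComponent :=
  {c | ∃ x ∈ X, ∃ w : S, w ∈ c.supp ∧ G.Adj x w}

end Boundary

end MatchingMeasure

namespace MatchingMeasure

open Filter Topology

/-! ### Projection onto an eigenspace as a limit of polynomials and of resolvents -/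

section Ergodic

variable {H : Type*} [NormedAddCommGroup H] [InnerProductSpace ℂ H]

/-! For a finite graph, the root entry of the resolvent of the path tree is the quotient of the
matching polynomials of G - o and G. Being essential then means that deleting the vertex lowers the
multiplicity of θ, and the theorem is a Gallai-Edmonds structure theorem. An infinite graph has no
matching polynomial. The proof works with the quotients alone: R_U(o) = `ratio G d U o` is the root
entry of the resolvent for G - U, and multiplicities become rates of growth at z = θ + iε as ε → 0+.

Three facts carry the argument. First, iε times the resolvent tends strongly to the projection onto
the θ-eigenspace, so iε R_U(o) tends to the mass at θ (`tendsto_ratio`). Second, the continued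
fraction 1/R_U(o) = z - ∑ R_{U+o}(v) over the neighbours v shows that iε/R_U(o) tends to minus the
total mass of the neighbours in G - U - o (`tendsto_inv_ratio`); call o positive if this is nonzero.
Third, R_U(u) R_{U+u}(v) is symmetric in u and v (`ratio_swap`). In a finite graph both orders give
the same quotient of matching polynomials. In general, for large Im z, any common bound on the
defects of symmetry can be halved, so the defects vanish, and analytic continuation gives the whole
upper half-plane.

For (a): the resolvent entry at a path is the product of the ratios along it, so by symmetry it is
unchanged when the path is reversed. Hence the projection of the root vector at an essential w
vanishes at every path ending in an inessential vertex, and it restricts to an eigenvector for the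
component of w in G[D] (`isEssential_of_restrict`).

For (b): deleting the vertices of X one by one leaves D unchanged, and every deletion is of positive
type, so (iε)^|X| divided by the product of the ratios has a nonzero limit (`boundary_stable`). This
stays true if an essential y is deleted before X. Unwinding the product matches every x in X to a
neighbour, such that y and these neighbours are successively essential in G - X
(`exists_essentialList`). By Gallai's lemma (`not_essentialIn_insert_of_reachable`) such a list
meets each component of G[D] at most once. Its |X| + 1 members give the required components. -/

theorem inner_self_eq_ofReal_norm_sq (y : H) : ⟪y, y⟫_ℂ = ((‖y‖ ^ 2 : ℝ) : ℂ) := by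
  rw [inner_self_eq_norm_sq_to_K]
  push_cast
  rfl

theorem IsSpectralMeasure.inner_aeval {A : H →L[ℂ] H} {x : H} {d : ℕ} {μ : Measure ℝ}
    (hμ : IsSpectralMeasure A x d μ) (p : Polynomial ℝ) :
    ⟪x, Polynomial.aeval A p x⟫_ℂ = ((∫ t, p.eval t ∂μ : ℝ) : ℂ) := by
  have := hμ.isProbabilityMeasure
  induction p using Polynomial.induction_on' with
  | add p q hp hq =>
    rw [map_add, add_apply, inner_add_right, hp, hq]
    simp only [Polynomial.eval_add]
    rw [integral_add (integrable_of_continuous hμ.support p.continuous)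
      (integrable_of_continuous hμ.support q.continuous)]
    push_cast; rfl
  | monomial n a =>
    have h : Polynomial.aeval A (Polynomial.monomial n a) x = (a : ℂ) • (A ^ n) x := by
      rw [Polynomial.aeval_monomial, ← Algebra.smul_def]
      simp
    rw [h, inner_smul_right, ← hμ.moment n]
    simp [integral_const_mul]

/-- A polynomial equal to `1` at `θ` and of absolute value less than `1` at the other points of
`[-d, d]`. -/
noncomputable def peak (d : ℕ) (θ : ℝ) : Polynomial ℝ :=
  1 - Polynomial.C ((d + |θ| + 1) ^ 2)⁻¹ * (Polynomial.X - Polynomial.C θ) ^ 2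

/-- On [-d, d] the peak takes values in [0, 1], and 1 only at θ, so its powers converge to the
indicator of {θ} and dominated convergence applies. -/
theorem tendsto_integral_peak {d : ℕ} {μ : Measure ℝ} [IsProbabilityMeasure μ]
    (hs : μ (Set.Icc (-(d : ℝ)) d)ᶜ = 0) (θ : ℝ) :
    Tendsto (fun k : ℕ => ∫ t, (peak d θ ^ k).eval t ∂μ) atTop (𝓝 (μ.real {θ})) := by
  have hc : (0 : ℝ) < d + |θ| + 1 := by positivity
  have hae : ∀ᵐ t ∂μ, t ∈ Set.Icc (-(d : ℝ)) d := by rw [ae_iff]; exact hs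
  have hev : ∀ t, (peak d θ).eval t = 1 - ((d + |θ| + 1) ^ 2)⁻¹ * (t - θ) ^ 2 := by
    intro t; simp [peak]
  have hb : ∀ t ∈ Set.Icc (-(d : ℝ)) d, (t - θ) ^ 2 < (d + |θ| + 1) ^ 2 := by
    intro t ht
    apply sq_lt_sq'
    · linarith [ht.1, le_abs_self θ]
    · linarith [ht.2, neg_abs_le θ]
  have hnn : ∀ t ∈ Set.Icc (-(d : ℝ)) d, 0 ≤ (peak d θ).eval t := by
    intro t ht
    rw [hev, inv_mul_eq_div, sub_nonneg, div_le_one (by positivity)]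
    exact (hb t ht).le
  have hle : ∀ t, (peak d θ).eval t ≤ 1 := by
    intro t
    rw [hev]
    have : 0 ≤ ((d + |θ| + 1) ^ 2)⁻¹ * (t - θ) ^ 2 := by positivity
    linarith
  rw [← integral_indicator_one (measurableSet_singleton θ)]
  refine tendsto_integral_of_dominated_convergence (fun _ => 1) ?_ (integrable_const _) ?_ ?_
  · intro k
    exact (peak d θ ^ k).continuous.aestronglyMeasurable
  · intro k
    filter_upwards [hae] with t ht
    rw [Polynomial.eval_pow, Real.norm_eq_abs, abs_of_nonneg (pow_nonneg (hnn t ht) _)]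
    exact pow_le_one₀ (hnn t ht) (hle t)
  · filter_upwards [hae] with t ht
    simp only [Polynomial.eval_pow]
    by_cases h : t = θ
    · subst h
      simp [hev]
    · have : (peak d θ).eval t < 1 := by
        rw [hev]
        have h1 : 0 < (t - θ) ^ 2 := by
          have := sub_ne_zero.mpr h
          positivity
        have : 0 < ((d + |θ| + 1) ^ 2)⁻¹ * (t - θ) ^ 2 := by positivity
        linarith
      simpa [h] using tendsto_pow_atTop_nhds_zero_of_lt_one (hnn t ht) this

/-- f is the orthogonal projection of x onto the θ-eigenspace, built as the limit of p(A)^k x for p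
the peak polynomial. Inner products of these vectors are integrals of powers of p, so scalar
convergence gives the Cauchy property. The last clause is the input of `tendsto_smul_resolvent`. -/
theorem exists_eigenvector_of_isSpectralMeasure [CompleteSpace H] {A : H →L[ℂ] H}
    (hA : IsSelfAdjoint A) {x : H} {d : ℕ} {μ : Measure ℝ} (hμ : IsSpectralMeasure A x d μ)
    (θ : ℝ) :
    ∃ f : H, A f = (θ : ℂ) • f ∧ (∀ g, A g = (θ : ℂ) • g → ⟪g, f⟫_ℂ = ⟪g, x⟫_ℂ) ∧
      ⟪x, f⟫_ℂ = (μ.real {θ} : ℂ) ∧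
      x - f ∈ closure (Set.range fun y => A y - (θ : ℂ) • y) := by
  have := hμ.isProbabilityMeasure
  set c : ℝ := d + |θ| + 1 with hc'
  have hc : 0 < c := by positivity
  set B : H →L[ℂ] H := A - (θ : ℂ) • 1 with hB
  have hBsa : IsSelfAdjoint B := by
    refine hA.sub ?_
    rw [isSelfAdjoint_iff, star_smul, star_one]
    simp
  set C : H →L[ℂ] H := Polynomial.aeval A (peak d θ) with hC
  have hCB : C = 1 - ((c ^ 2)⁻¹ : ℝ) • B ^ 2 := by
    rw [hC, peak, map_sub, map_one, map_mul, map_pow, map_sub, Polynomial.aeval_X,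
      Polynomial.aeval_C, Polynomial.aeval_C, ← Algebra.smul_def, hB, ← hc']
    congr 3
  have hCsa : ∀ k, IsSelfAdjoint (C ^ k) := by
    intro k
    refine IsSelfAdjoint.pow ?_ k
    rw [hCB]
    exact (IsSelfAdjoint.one _).sub ((IsSelfAdjoint.all _).smul (hBsa.pow 2))
  have hsymm : ∀ k y z, ⟪(C ^ k) y, z⟫_ℂ = ⟪y, (C ^ k) z⟫_ℂ := fun k =>
    (hCsa k).isSymmetric
  have hBsymm : ∀ y z, ⟪B y, z⟫_ℂ = ⟪y, B z⟫_ℂ := hBsa.isSymmetric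
  let a : ℕ → ℝ := fun k => ∫ t, (peak d θ ^ k).eval t ∂μ
  have ha : ∀ k, ⟪x, (C ^ k) x⟫_ℂ = (a k : ℂ) := by
    intro k
    rw [hC, ← map_pow, hμ.inner_aeval]
  have hat : Tendsto a atTop (𝓝 (μ.real {θ})) := tendsto_integral_peak hμ.support θ
  have hip : ∀ k l, ⟪(C ^ k) x, (C ^ l) x⟫_ℂ = (a (k + l) : ℂ) := by
    intro k l
    rw [hsymm, ← ha, pow_add]
    rfl
  have hdist : ∀ k l, ‖(C ^ k) x - (C ^ l) x‖ ^ 2 = a (k + k) - 2 * a (k + l) + a (l + l) := by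
    intro k l
    have h1 : ((‖(C ^ k) x - (C ^ l) x‖ ^ 2 : ℝ) : ℂ) =
        ((a (k + k) - 2 * a (k + l) + a (l + l) : ℝ) : ℂ) := by
      rw [← inner_self_eq_ofReal_norm_sq, inner_sub_left, inner_sub_right,
        inner_sub_right, hip, hip, hip, hip, add_comm l k]
      push_cast
      ring
    exact_mod_cast h1
  have hcau : CauchySeq fun k => (C ^ k) x := by
    rw [Metric.cauchySeq_iff']
    intro ε hε
    -- The squared distance combines three terms with weights 1, -2, 1, each within ε²/4 of the same
    -- limit.
    obtain ⟨N, hN⟩ := (Metric.tendsto_atTop.mp hat) (ε ^ 2 / 4) (by positivity)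
    refine ⟨N, fun n hn => ?_⟩
    have h1 := abs_lt.mp (hN (n + n) (by omega))
    have h2 := abs_lt.mp (hN (n + N) (by omega))
    have h3 := abs_lt.mp (hN (N + N) (by omega))
    rw [dist_eq_norm]
    refine lt_of_pow_lt_pow_left₀ 2 hε.le ?_
    rw [hdist]
    linarith [h1.2, h2.1, h3.2]
  obtain ⟨f, hf⟩ := cauchySeq_tendsto_of_complete hcau
  -- B² = c²(1 - C), so ‖B Cᵏx‖² is c² times the difference of two consecutive terms of a convergent
  -- sequence.
  have hBf : B f = 0 := by
    have h1 : Tendsto (fun k => B ((C ^ k) x)) atTop (𝓝 (B f)) :=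
      (B.continuous.tendsto f).comp hf
    have h2 : ∀ k, ‖B ((C ^ k) x)‖ ^ 2 = c ^ 2 * (a (k + k) - a (k + k + 1)) := by
      intro k
      have h3 : (B ^ 2 : H →L[ℂ] H) = ((c ^ 2 : ℝ)) • (1 - C) := by
        rw [hCB, sub_sub_cancel, smul_smul, mul_inv_cancel₀ (by positivity), one_smul]
      have h4 : B (B ((C ^ k) x)) = (c ^ 2 : ℝ) • ((C ^ k) x - (C ^ (k + 1)) x) := by
        have : B (B ((C ^ k) x)) = (B ^ 2) ((C ^ k) x) := by rw [pow_two]; rfl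
        rw [this, h3, pow_succ' C k]
        rfl
      have h5 : ((‖B ((C ^ k) x)‖ ^ 2 : ℝ) : ℂ) =
          ((c ^ 2 * (a (k + k) - a (k + k + 1)) : ℝ) : ℂ) := by
        rw [← inner_self_eq_ofReal_norm_sq, hBsymm, h4, inner_smul_right_eq_smul,
          inner_sub_right, hip, hip, add_assoc k k 1]
        simp
      exact_mod_cast h5
    have h6 : Tendsto (fun k => ‖B ((C ^ k) x)‖ ^ 2) atTop (𝓝 0) := by
      simp only [h2]
      have h7 : Tendsto (fun k : ℕ => k + k) atTop atTop :=
        tendsto_atTop_mono (fun k => Nat.le_add_left k k) tendsto_id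
      have := ((hat.comp h7).sub (hat.comp ((tendsto_add_atTop_nat 1).comp h7))).const_mul (c ^ 2)
      simpa [Function.comp_def] using this
    have h7 := tendsto_nhds_unique ((h1.norm).pow 2) h6
    simpa using h7
  have hBv : ∀ y, B y = A y - (θ : ℂ) • y := fun y => by simp [hB]
  refine ⟨f, ?_, ?_, ?_, ?_⟩
  · rw [hBv] at hBf
    exact sub_eq_zero.mp hBf
  · intro g hg
    have hCg : ∀ k, (C ^ k) g = g := by
      intro k
      have : C g = g := by
        have h1 : B g = 0 := by rw [hBv, hg, sub_self]
        rw [hCB]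
        simp [pow_two, h1]
      induction k with
      | zero => rfl
      | succ k ih => rw [pow_succ]; exact (congrArg _ this).trans ih
    have h1 : Tendsto (fun k => ⟪g, (C ^ k) x⟫_ℂ) atTop (𝓝 ⟪g, f⟫_ℂ) :=
      tendsto_const_nhds.inner hf
    simp only [← hsymm, hCg] at h1
    exact tendsto_nhds_unique h1 tendsto_const_nhds
  · have h1 : Tendsto (fun k => ⟪x, (C ^ k) x⟫_ℂ) atTop (𝓝 ⟪x, f⟫_ℂ) :=
      tendsto_const_nhds.inner hf
    simp only [ha] at h1
    exact tendsto_nhds_unique h1 ((Complex.continuous_ofReal.tendsto _).comp hat)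
  · refine mem_closure_of_tendsto (tendsto_const_nhds.sub hf) (Eventually.of_forall fun k => ?_)
    -- 1 - C divides 1 - Cᵏ by the geometric sum, and 1 - C is a multiple of B².
    have h1 : ∀ k, ∃ D : H →L[ℂ] H, 1 - C ^ k = B * D := by
      intro k
      refine ⟨((c ^ 2)⁻¹ : ℝ) • (B * ∑ i ∈ Finset.range k, C ^ i), ?_⟩
      have h2 : (1 : H →L[ℂ] H) - C = ((c ^ 2)⁻¹ : ℝ) • (B * B) := by
        rw [hCB, sub_sub_cancel, pow_two B]
      rw [← mul_neg_geom_sum, h2, smul_mul_assoc, mul_smul_comm, mul_assoc]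
    obtain ⟨D, hD⟩ := h1 k
    refine ⟨D x, ?_⟩
    have := congrArg (fun T : H →L[ℂ] H => T x) hD
    simp only [← hBv]
    exact this.symm

theorem abs_im_mul_norm_le [CompleteSpace H] {A : H →L[ℂ] H} (hA : IsSelfAdjoint A) (z : ℂ)
    (y : H) : |z.im| * ‖y‖ ≤ ‖z • y - A y‖ := by
  by_cases hy : y = 0
  · simp [hy]
  have h0 : 0 < ‖y‖ := norm_pos_iff.mpr hy
  refine le_of_mul_le_mul_right ?_ h0
  have h1 : (⟪y, z • y - A y⟫_ℂ).im = z.im * ‖y‖ ^ 2 := by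
    have h2 : (⟪y, A y⟫_ℂ).im = 0 := hA.isSymmetric.im_inner_self_apply y
    rw [inner_sub_right, inner_smul_right, inner_self_eq_ofReal_norm_sq, Complex.sub_im, h2,
      Complex.mul_im, Complex.ofReal_re, Complex.ofReal_im]
    ring
  calc |z.im| * ‖y‖ * ‖y‖ = |(⟪y, z • y - A y⟫_ℂ).im| := by
        rw [h1, abs_mul, abs_of_nonneg (sq_nonneg ‖y‖)]; ring
    _ ≤ ‖⟪y, z • y - A y⟫_ℂ‖ := Complex.abs_im_le_norm _
    _ ≤ ‖y‖ * ‖z • y - A y‖ := norm_inner_le_norm _ _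
    _ = _ := mul_comm _ _

theorem mem_resolventSet_of_im_ne_zero [CompleteSpace H] {A : H →L[ℂ] H} (hA : IsSelfAdjoint A)
    {z : ℂ} (hz : z.im ≠ 0) : z ∈ resolventSet ℂ A := by
  by_contra h
  exact hz (hA.im_eq_zero_of_mem_spectrum h)

theorem resolvent_apply_iff [CompleteSpace H] {A : H →L[ℂ] H} (hA : IsSelfAdjoint A) {z : ℂ}
    (hz : z.im ≠ 0) (x y : H) : z • y - A y = x ↔ y = resolvent A z x := by
  have hu := mem_resolventSet_of_im_ne_zero hA hz
  rw [spectrum.mem_resolventSet_iff] at hu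
  have he : ∀ y, z • y - A y = (algebraMap ℂ (H →L[ℂ] H) z - A) y := fun y => by
    simp [Algebra.algebraMap_eq_smul_one]
  rw [he, resolvent]
  constructor
  · rintro rfl
    exact (congrArg (fun T : H →L[ℂ] H => T y) (Ring.inverse_mul_cancel _ hu)).symm
  · rintro rfl
    exact congrArg (fun T : H →L[ℂ] H => T x) (Ring.mul_inverse_cancel _ hu)

theorem norm_resolvent_apply_le [CompleteSpace H] {A : H →L[ℂ] H} (hA : IsSelfAdjoint A) {z : ℂ}
    (hz : z.im ≠ 0) (x : H) : ‖resolvent A z x‖ ≤ ‖x‖ / |z.im| := by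
  have h1 := abs_im_mul_norm_le hA z (resolvent A z x)
  rw [(resolvent_apply_iff hA hz x _).mpr rfl] at h1
  rw [le_div_iff₀ (abs_pos.mpr hz)]
  linarith

/-- The operators iε(θ + iε - A)⁻¹ have norm at most 1, fix f, and send (A - θ)g to a vector of norm
at most 2ε‖g‖. Approximating x - f by such vectors gives the limit. -/
theorem tendsto_smul_resolvent [CompleteSpace H] {A : H →L[ℂ] H} (hA : IsSelfAdjoint A) (θ : ℝ)
    {x f : H} (hf : A f = (θ : ℂ) • f)
    (hxf : x - f ∈ closure (Set.range fun y => A y - (θ : ℂ) • y)) :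
    Tendsto (fun ε : ℝ => (Complex.I * ε) • resolvent A (θ + Complex.I * ε) x) (𝓝[>] 0) (𝓝 f) := by
  rw [Metric.tendsto_nhdsWithin_nhds]
  intro η hη
  rw [Metric.mem_closure_iff] at hxf
  obtain ⟨_, ⟨g, rfl⟩, hg⟩ := hxf (η / 2) (by positivity)
  refine ⟨η / (4 * (‖g‖ + 1)), by positivity, fun ε hε hε' => ?_⟩
  have hε0 : 0 < ε := hε
  have hεb : ε * ‖g‖ < η / 4 := by
    rw [Real.dist_eq, sub_zero, abs_of_pos hε0, lt_div_iff₀ (by positivity)] at hε'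
    nlinarith [norm_nonneg g]
  set z : ℂ := θ + Complex.I * ε with hz
  have hzim : z.im = ε := by simp [hz]
  have hz0 : z.im ≠ 0 := by rw [hzim]; exact hε0.ne'
  have hn : ‖Complex.I * (ε : ℂ)‖ = ε := by simp [abs_of_pos hε0]
  have hI : Complex.I * (ε : ℂ) ≠ 0 := by simp [hε0.ne']
  have h1 : (Complex.I * (ε : ℂ)) • resolvent A z f = f := by
    have : (Complex.I * (ε : ℂ))⁻¹ • f = resolvent A z f := by
      rw [← resolvent_apply_iff hA hz0, map_smul, hf, smul_comm z, ← smul_sub, ← sub_smul, hz, add_sub_cancel_left, smul_smul,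
        inv_mul_cancel₀ hI, one_smul]
    rw [← this, smul_smul, mul_inv_cancel₀ hI, one_smul]
  have h2 : resolvent A z (A g - (θ : ℂ) • g) = (Complex.I * (ε : ℂ)) • resolvent A z g - g := by
    symm
    rw [← resolvent_apply_iff hA hz0, map_sub, smul_sub, map_smul, smul_comm z, sub_sub_sub_comm,
      ← smul_sub, (resolvent_apply_iff hA hz0 g _).mpr rfl, hz, add_smul]
    abel
  have h3 : ‖(Complex.I * (ε : ℂ)) • resolvent A z g‖ ≤ ‖g‖ := by
    rw [norm_smul, hn]
    have := norm_resolvent_apply_le hA hz0 g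
    rw [hzim, abs_of_pos hε0, le_div_iff₀ hε0] at this
    linarith
  have h4 : ‖(Complex.I * (ε : ℂ)) • resolvent A z (x - f - (A g - (θ : ℂ) • g))‖ < η / 2 := by
    rw [dist_eq_norm] at hg
    refine lt_of_le_of_lt ?_ hg
    rw [norm_smul, hn]
    have := norm_resolvent_apply_le hA hz0 (x - f - (A g - (θ : ℂ) • g))
    rw [hzim, abs_of_pos hε0, le_div_iff₀ hε0] at this
    linarith
  have h5 : (Complex.I * (ε : ℂ)) • resolvent A z x - f =
      (Complex.I * (ε : ℂ)) • resolvent A z (x - f - (A g - (θ : ℂ) • g)) +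
      (Complex.I * (ε : ℂ)) • ((Complex.I * (ε : ℂ)) • resolvent A z g - g) := by
    rw [← h2, ← smul_add, ← map_add, sub_add_cancel, map_sub, smul_sub, h1]
  rw [dist_eq_norm, h5]
  calc _ ≤ _ := norm_add_le _ _
    _ < η / 2 + η / 2 := by
      refine add_lt_add h4 ?_
      rw [norm_smul, hn]
      have := norm_sub_le ((Complex.I * (ε : ℂ)) • resolvent A z g) g
      nlinarith [norm_nonneg g]
    _ = η := by ring

end Ergodic

/-! ### Paths as vertex lists with the last vertex first, so that adding an edge is `List.cons` -/

section RevSupport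

variable {V : Type u} {G : SimpleGraph V} {o : V}

/-- The list of the vertices of a path, its last vertex first. -/
def revSupport (P : PathsFrom G o) : List V := (P.2 : G.Walk o P.1).support.reverse

/-- `l` is the reversed vertex list of a path of `G` starting at `o`. -/
def IsRevPath (G : SimpleGraph V) (o : V) (l : List V) : Prop :=
  l.IsChain G.Adj ∧ l.Nodup ∧ l.getLast? = some o

theorem revSupport_injective : Function.Injective (revSupport : PathsFrom G o → List V) := by
  rintro ⟨v, p, hp⟩ ⟨w, q, hq⟩ h
  have h' : p.support = q.support := List.reverse_injective h
  have hvw : v = w := by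
    rw [← p.getLast_support, ← q.getLast_support]
    simp only [h']
  subst hvw
  have : p = q := SimpleGraph.Walk.ext_support h'
  subst this
  rfl

theorem revSupport_eq_cons (P : PathsFrom G o) :
    revSupport P = P.1 :: (revSupport P).tail := by
  obtain ⟨v, p, hp⟩ := P
  unfold revSupport
  cases h : p.support.reverse with
  | nil => simp at h
  | cons a l =>
    have h1 := p.getLast_support
    have h2 : p.support = (a :: l).reverse := by rw [← h, List.reverse_reverse]
    simp only [h2] at h1
    simp at h1
    simp [h1]

theorem exists_revSupport_iff {l : List V} :
    (∃ P : PathsFrom G o, revSupport P = l) ↔ IsRevPath G o l := by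
  constructor
  · rintro ⟨⟨v, p, hp⟩, rfl⟩
    refine ⟨?_, ?_, ?_⟩
    · unfold revSupport
      rw [List.isChain_reverse]
      refine p.isChain_adj_support.imp fun a b h => h.symm
    · exact List.nodup_reverse.mpr hp.support_nodup
    · simp only [revSupport, List.getLast?_reverse]
      rw [← p.cons_tail_support]
      rfl
  · rintro ⟨hc, hn, hl⟩
    have hne : l.reverse ≠ [] := by
      rintro h
      simp at h
      simp [h] at hl
    have hc' : l.reverse.IsChain G.Adj := by
      rw [List.isChain_reverse]
      exact hc.imp fun a b h => h.symm
    have hhead : l.reverse.head hne = o := by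
      rw [List.head_reverse]
      rw [List.getLast?_eq_some_getLast (by simpa using hne)] at hl
      simpa using hl
    refine ⟨⟨_, ((SimpleGraph.Walk.ofSupport l.reverse hne hc').copy hhead rfl), ?_⟩, ?_⟩
    · rw [SimpleGraph.Walk.isPath_def]
      simpa using hn
    · simp [revSupport]

theorem isRevPath_revSupport (P : PathsFrom G o) : IsRevPath G o (revSupport P) :=
  exists_revSupport_iff.mp ⟨P, rfl⟩

theorem isOneStepExtension_iff {P Q : PathsFrom G o} :
    IsOneStepExtension P Q ↔ revSupport Q = Q.1 :: revSupport P := by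
  constructor
  · rintro ⟨h, e⟩
    simp [revSupport, e, SimpleGraph.Walk.support_concat]
  · intro h
    have hc := (isRevPath_revSupport Q).1
    rw [h, revSupport_eq_cons P, List.isChain_cons_cons] at hc
    have ha : G.Adj P.1 Q.1 := hc.1.symm
    refine ⟨ha, SimpleGraph.Walk.ext_support ?_⟩
    rw [SimpleGraph.Walk.support_concat]
    apply List.reverse_injective
    simpa [revSupport] using h

theorem revSupport_trivialPath : revSupport (trivialPath G o) = [o] := by
  simp [revSupport, trivialPath]

theorem eq_trivialPath_iff {P : PathsFrom G o} : P = trivialPath G o ↔ revSupport P = [o] := by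
  rw [← revSupport_trivialPath (G := G), revSupport_injective.eq_iff]

theorem IsRevPath.singleton : IsRevPath G o [o] := by
  simp [IsRevPath]

theorem IsRevPath.cons {x y : V} {l : List V} (h : IsRevPath G o (x :: l)) (ha : G.Adj x y)
    (hy : y ∉ x :: l) : IsRevPath G o (y :: x :: l) := by
  refine ⟨?_, ?_, ?_⟩
  · rw [List.isChain_cons_cons]
    exact ⟨ha.symm, h.1⟩
  · exact List.nodup_cons.mpr ⟨hy, h.2.1⟩
  · have := h.2.2
    rwa [List.getLast?_cons_cons]

theorem IsRevPath.of_cons_cons {x y : V} {l : List V} (h : IsRevPath G o (y :: x :: l)) :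
    IsRevPath G o (x :: l) ∧ G.Adj x y ∧ y ∉ x :: l := by
  obtain ⟨h1, h2, h3⟩ := h
  rw [List.isChain_cons_cons] at h1
  rw [List.nodup_cons] at h2
  rw [List.getLast?_cons_cons] at h3
  exact ⟨⟨h1.2, h2.2, h3⟩, h1.1.symm, h2.1⟩

theorem IsRevPath.ne_nil {l : List V} (h : IsRevPath G o l) : l ≠ [] := by
  rintro rfl
  simp [IsRevPath] at h

variable (d : ℕ) [DegreeAtMost G d]

open Classical in
/-- The sum over the neighbours of a vertex of the path tree, in terms of vertex lists. -/
theorem sum_nbrs_pathTree {f : List V → ℂ} (hf : f [] = 0) (P : PathsFrom G o) :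
    ∑ Q ∈ nbrs (pathTree G o) d P, f (revSupport Q) =
      ∑ y ∈ nbrs G d P.1 with y ∉ revSupport P, f (y :: revSupport P) +
        f (revSupport P).tail := by
  have hs := revSupport_eq_cons P
  -- The tail of the list is the parent of P. The trivial path has none: its tail is `[]`, which the
  -- filter drops and where f is 0 by assumption.
  have key : (nbrs (pathTree G o) d P).image revSupport =
      ((nbrs G d P.1).filter (· ∉ revSupport P)).image (· :: revSupport P) ∪
        ({(revSupport P).tail} : Finset (List V)).filter (· ≠ []) := by
    ext l
    simp only [Finset.mem_image, mem_nbrs, Finset.mem_union, Finset.mem_filter,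
      Finset.mem_singleton]
    constructor
    · rintro ⟨Q, h | h, rfl⟩
      · left
        have h1 := h.notMem
        obtain ⟨ha, -⟩ := id h
        rw [isOneStepExtension_iff] at h
        exact ⟨Q.1, ⟨ha, by simpa [revSupport] using h1⟩, h.symm⟩
      · right
        rw [isOneStepExtension_iff] at h
        rw [h]
        exact ⟨rfl, (isRevPath_revSupport Q).ne_nil⟩
    · rintro (⟨y, ⟨h1, h2⟩, rfl⟩ | ⟨rfl, h⟩)
      · rw [hs] at h2
        have := isRevPath_revSupport P
        rw [hs] at this
        obtain ⟨Q, hQ⟩ := exists_revSupport_iff.mpr (this.cons h1 h2)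
        rw [← hs] at hQ
        refine ⟨Q, Or.inl ?_, hQ⟩
        rw [isOneStepExtension_iff, hQ]
        have := revSupport_eq_cons Q
        rw [hQ] at this
        rw [← (List.cons.inj this).1]
      · obtain ⟨x, l, hxl⟩ := List.exists_cons_of_ne_nil h
        have := isRevPath_revSupport P
        rw [hs, hxl] at this
        obtain ⟨Q, hQ⟩ := exists_revSupport_iff.mpr this.of_cons_cons.1
        refine ⟨Q, Or.inr ?_, by rw [hQ, hxl]⟩
        rw [isOneStepExtension_iff, hQ, hs, hxl]
  rw [← Finset.sum_image (f := f) (g := revSupport) revSupport_injective.injOn, key,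
    Finset.sum_union, Finset.sum_image]
  · congr 1
    rw [Finset.sum_filter]
    by_cases h : (revSupport P).tail = [] <;> simp [h, hf]
  · intro a _ b _ h
    exact (List.cons.inj h).1
  · rw [Finset.disjoint_left]
    rintro l h1 h2
    simp only [Finset.mem_image, Finset.mem_filter, Finset.mem_singleton] at h1 h2
    obtain ⟨y, -, rfl⟩ := h1
    have := congrArg List.length h2.1
    simp at this
    omega

/-- A square summable function on the path tree, as a function of vertex lists. -/
noncomputable def listFun (g : lp (fun _ : PathsFrom G o => ℂ) 2) : List V → ℂ :=
  Function.extend revSupport g 0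

theorem listFun_revSupport (g : lp (fun _ : PathsFrom G o => ℂ) 2) (P : PathsFrom G o) :
    listFun g (revSupport P) = g P :=
  revSupport_injective.extend_apply _ _ _

theorem listFun_nil (g : lp (fun _ : PathsFrom G o => ℂ) 2) : listFun g [] = 0 := by
  refine Function.extend_apply' _ _ _ ?_
  rw [exists_revSupport_iff]
  exact fun h => h.ne_nil rfl

open Classical in
theorem adjacencyOperator_pathTree_apply (g : lp (fun _ : PathsFrom G o => ℂ) 2) {x : V}
    {l : List V} (P : PathsFrom G o) (hP : revSupport P = x :: l) :
    adjacencyOperator (pathTree G o) d g P =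
      ∑ y ∈ nbrs G d x with y ∉ x :: l, listFun g (y :: x :: l) + listFun g l := by
  have hx : P.1 = x := by
    have := revSupport_eq_cons P
    rw [hP] at this
    exact (List.cons.inj this).1.symm
  rw [adjacencyOperator_apply]
  have := sum_nbrs_pathTree d (listFun_nil g) P
  rw [hP, hx] at this
  simpa only [listFun_revSupport, List.tail_cons] using this

theorem chi_trivialPath_apply (P : PathsFrom G o) :
    chi (trivialPath G o) P = if (revSupport P).tail = [] then 1 else 0 := by
  classical
  have : (revSupport P).tail = [] ↔ P = trivialPath G o := by
    rw [eq_trivialPath_iff]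
    constructor
    · intro h
      have h1 := isRevPath_revSupport P
      rw [revSupport_eq_cons, h] at h1 ⊢
      have := h1.2.2
      simpa using this
    · intro h; simp [h]
  simp only [this, chi, lp.coeFn_single, Pi.single_apply]

/-- Pulling back a square summable function along an injective map. -/
theorem memℓp_comp_injective {α β : Type*} (g : lp (fun _ : β => ℂ) 2) {ι : α → β}
    (hι : Function.Injective ι) : Memℓp (fun a => (g (ι a) : ℂ)) 2 := by
  have h := (lp.memℓp g).summable (by simp)
  exact memℓp_gen (h.comp_injective hι)

end RevSupport

/-! ### Vertex deletion and the Green function of the path tree -/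

section Green

variable {V : Type u}

/-- The graph obtained from `G` by isolating the vertices of `U`. -/
def del (G : SimpleGraph V) (U : Set V) : SimpleGraph V where
  Adj a b := G.Adj a b ∧ a ∉ U ∧ b ∉ U
  symm := ⟨fun _ _ h => ⟨h.1.symm, h.2.2, h.2.1⟩⟩
  loopless := ⟨fun _ h => h.1.ne rfl⟩

theorem del_adj {G : SimpleGraph V} {U : Set V} {a b : V} :
    (del G U).Adj a b ↔ G.Adj a b ∧ a ∉ U ∧ b ∉ U := Iff.rfl

theorem del_empty (G : SimpleGraph V) : del G ∅ = G := by
  ext a b; simp [del_adj]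

theorem del_del (G : SimpleGraph V) (U W : Set V) : del (del G U) W = del G (U ∪ W) := by
  ext a b; simp only [del_adj, Set.mem_union]; tauto

instance del.degreeAtMost (G : SimpleGraph V) (d : ℕ) [DegreeAtMost G d] (U : Set V) :
    DegreeAtMost (del G U) d where
  encard_le v := by
    refine le_trans (Set.encard_le_encard ?_) (DegreeAtMost.encard_le (G := G) (d := d) v)
    exact fun w h => h.1

theorem IsRevPath.mem_of_closed {G : SimpleGraph V} {o : V} {S : Set V} (ho : o ∈ S)
    (hS : ∀ a ∈ S, ∀ b, G.Adj a b → b ∈ S) {l : List V} (h : IsRevPath G o l) :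
    ∀ x ∈ l, x ∈ S := by
  induction l with
  | nil => simp
  | cons y l ih =>
    cases l with
    | nil =>
      have := h.2.2
      simp only [List.getLast?_singleton, Option.some.injEq] at this
      simpa [this] using ho
    | cons x l =>
      obtain ⟨h1, h2, -⟩ := h.of_cons_cons
      have := ih h1
      intro w hw
      rcases List.mem_cons.mp hw with rfl | hw
      · exact hS x (this x (by simp)) _ h2
      · exact this w hw

theorem IsRevPath.notMem_of_del {G : SimpleGraph V} {U : Set V} {o : V} (ho : o ∉ U) {l : List V}
    (h : IsRevPath (del G U) o l) : ∀ x ∈ l, x ∉ U :=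
  h.mem_of_closed (S := Uᶜ) ho fun _ _ _ hab => (del_adj.mp hab).2.2

theorem IsRevPath.append_root {G : SimpleGraph V} {o v : V} (hv : G.Adj o v) {l : List V}
    (h : IsRevPath (del G {o}) v l) : IsRevPath G o (l ++ [o]) := by
  have hn := h.notMem_of_del (by simpa using hv.ne')
  refine ⟨?_, ?_, by simp⟩
  · rw [List.isChain_append]
    refine ⟨h.1.imp fun a b hab => hab.1, by simp, ?_⟩
    intro x hx y hy
    rw [h.2.2] at hx
    simp at hx hy
    subst hx hy
    exact hv.symm
  · rw [List.nodup_append]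
    refine ⟨h.2.1, by simp, ?_⟩
    intro a ha b hb
    simp only [List.mem_singleton] at hb
    subst hb
    exact hn a ha

theorem IsRevPath.map {W : Type*} {G : SimpleGraph V} {G' : SimpleGraph W} {o : W} (φ : W → V)
    (hφ : Function.Injective φ) (hadj : ∀ a b, G'.Adj a b → G.Adj (φ a) (φ b)) {l : List W}
    (h : IsRevPath G' o l) : IsRevPath G (φ o) (l.map φ) := by
  refine ⟨?_, h.2.1.map hφ, by simp [h.2.2]⟩
  rw [List.isChain_map]
  exact h.1.imp hadj

/-- Pulling back a square summable function on a path tree to another path tree. -/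
theorem exists_pullback {W : Type*} {G : SimpleGraph V} {G' : SimpleGraph W} {o : V} {o' : W}
    {ι : List W → List V} (hι : Function.Injective ι)
    (h : ∀ l, IsRevPath G' o' l → IsRevPath G o (ι l)) (g : lp (fun _ : PathsFrom G o => ℂ) 2) :
    ∃ g' : lp (fun _ : PathsFrom G' o' => ℂ) 2,
      ∀ l, IsRevPath G' o' l → listFun g' l = listFun g (ι l) := by
  choose J hJ using fun Q : PathsFrom G' o' =>
    exists_revSupport_iff.mpr (h _ (isRevPath_revSupport Q))
  have hinj : Function.Injective J := by
    intro Q Q' hQ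
    have h1 := hJ Q
    rw [hQ, hJ Q'] at h1
    exact (revSupport_injective (hι h1)).symm
  refine ⟨⟨fun Q => g (J Q), memℓp_comp_injective g hinj⟩, fun l hl => ?_⟩
  obtain ⟨Q, rfl⟩ := exists_revSupport_iff.mpr hl
  rw [listFun_revSupport, ← hJ, listFun_revSupport]

variable (G : SimpleGraph V) (d : ℕ) [DegreeAtMost G d]

/-- The resolvent of the path tree applied to the characteristic vector of its root, as a function
of vertex lists. -/
noncomputable def green (o : V) (z : ℂ) : List V → ℂ :=
  listFun (resolvent (adjacencyOperator (pathTree G o) d) z (chi (trivialPath G o)))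

open Classical in
theorem green_eq {o : V} {z : ℂ} (hz : z.im ≠ 0) {x : V} {l : List V}
    (h : IsRevPath G o (x :: l)) :
    z * green G d o z (x :: l) -
        (∑ y ∈ nbrs G d x with y ∉ x :: l, green G d o z (y :: x :: l) + green G d o z l) =
      if l = [] then 1 else 0 := by
  obtain ⟨P, hP⟩ := exists_revSupport_iff.mpr h
  have h1 := (resolvent_apply_iff (isSelfAdjoint_adjacencyOperator (pathTree G o) d) hz
    (chi (trivialPath G o)) _).mpr rfl
  have h2 := congrArg (fun f : lp (fun _ : PathsFrom G o => ℂ) 2 => f P) h1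
  simp only [lp.coeFn_sub, lp.coeFn_smul, Pi.sub_apply, Pi.smul_apply, smul_eq_mul,
    adjacencyOperator_pathTree_apply d _ P hP, chi_trivialPath_apply, hP, List.tail_cons] at h2
  rw [← listFun_revSupport, hP] at h2
  exact h2

-- z - A is invertible for nonreal z, so a square summable solution of the recursion is determined
-- by its source at the root. This identifies restrictions to subtrees.
open Classical in
theorem green_unique {o : V} {z : ℂ} (hz : z.im ≠ 0) {g : lp (fun _ : PathsFrom G o => ℂ) 2}
    {c : ℂ} (h : ∀ x l, IsRevPath G o (x :: l) →
      z * listFun g (x :: l) -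
        (∑ y ∈ nbrs G d x with y ∉ x :: l, listFun g (y :: x :: l) + listFun g l) =
      if l = [] then c else 0) {l : List V} (hl : IsRevPath G o l) :
    listFun g l = c * green G d o z l := by
  have h1 : z • g - adjacencyOperator (pathTree G o) d g = c • chi (trivialPath G o) := by
    ext P
    obtain ⟨x, l', hP⟩ : ∃ x l', revSupport P = x :: l' := ⟨_, _, revSupport_eq_cons P⟩
    have h2 := isRevPath_revSupport P
    rw [hP] at h2
    simp only [lp.coeFn_sub, lp.coeFn_smul, Pi.sub_apply, Pi.smul_apply, smul_eq_mul,
      adjacencyOperator_pathTree_apply d _ P hP, chi_trivialPath_apply, hP, List.tail_cons]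
    rw [← listFun_revSupport, hP, h _ _ h2]
    simp
  rw [resolvent_apply_iff (isSelfAdjoint_adjacencyOperator (pathTree G o) d) hz, map_smul] at h1
  obtain ⟨P, rfl⟩ := exists_revSupport_iff.mpr hl
  rw [green, listFun_revSupport, listFun_revSupport, h1]
  rfl

/-- The part of the path tree beyond the path o, v is the path tree of G - o rooted at v. There the
Green function of G solves the resolvent equation, with its value at `[o]` acting as the source. -/
theorem green_append_root {o v : V} (hv : G.Adj o v) {z : ℂ} (hz : z.im ≠ 0) {l : List V}
    (hl : IsRevPath (del G {o}) v l) :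
    green G d o z (l ++ [o]) = green G d o z [o] * green (del G {o}) d v z l := by
  classical
  obtain ⟨g', hg'⟩ := exists_pullback (ι := (· ++ [o])) (List.append_left_injective [o])
    (fun l (h : IsRevPath (del G {o}) v l) => h.append_root hv)
    (resolvent (adjacencyOperator (pathTree G o) d) z (chi (trivialPath G o)))
  have := green_unique (del G {o}) d hz (g := g') (c := green G d o z [o]) ?_ hl
  · rw [← this, hg' l hl]
    rfl
  · intro x l h
    have hxo : ∀ y ∈ x :: l, y ∉ ({o} : Set V) := h.notMem_of_del (by simpa using hv.ne')
    have h1 := green_eq G d hz (x := x) (l := l ++ [o]) (h.append_root hv)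
    have hs : ((nbrs G d x).filter (· ∉ x :: (l ++ [o]))) =
        (nbrs (del G {o}) d x).filter (· ∉ x :: l) := by
      ext y
      have := hxo x (by simp)
      simp only [Finset.mem_filter, mem_nbrs, del_adj, List.mem_cons, List.mem_append,
        List.not_mem_nil, or_false, Set.mem_singleton_iff] at *
      tauto
    have h2 : ∀ y ∈ (nbrs (del G {o}) d x).filter (· ∉ x :: l),
        listFun g' (y :: x :: l) = green G d o z (y :: x :: (l ++ [o])) := by
      intro y hy
      rw [Finset.mem_filter, mem_nbrs] at hy
      exact hg' _ (h.cons hy.1 hy.2)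
    rw [Finset.sum_congr rfl h2, hg' _ h]
    rw [hs] at h1
    -- The path `[v]` has the parent `[o]` in the large tree and no parent in the small one; the
    -- discrepancy becomes the source term.
    have h3 : listFun g' l = green G d o z (l ++ [o]) - if l = [] then green G d o z [o] else 0 := by
      cases l with
      | nil => simp [listFun_nil]
      | cons y l =>
        rw [if_neg (List.cons_ne_nil _ _), sub_zero]
        exact hg' _ h.of_cons_cons.1
    rw [h3]
    simp only [List.append_eq_nil_iff, List.cons_ne_self, and_false, if_false] at h1
    change z * green G d o z (x :: (l ++ [o])) - _ = _
    linear_combination h1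

/-- Continued fraction form of the matching polynomial recursion μ(G) = z μ(G - o) - ∑ μ(G - o - v).
-/
theorem green_root {o : V} {z : ℂ} (hz : z.im ≠ 0) :
    green G d o z [o] * (z - ∑ v ∈ nbrs G d o, green (del G {o}) d v z [v]) = 1 := by
  classical
  have h1 := green_eq G d hz (IsRevPath.singleton (G := G) (o := o))
  have h2 : (nbrs G d o).filter (· ∉ [o]) = nbrs G d o := by
    refine Finset.filter_true_of_mem fun y hy => ?_
    rw [mem_nbrs] at hy
    simpa using hy.ne'
  have h3 : ∀ v ∈ nbrs G d o, green G d o z [v, o] =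
      green G d o z [o] * green (del G {o}) d v z [v] := by
    intro v hv
    rw [mem_nbrs] at hv
    exact green_append_root G d hv hz IsRevPath.singleton
  rw [h2, Finset.sum_congr rfl h3, ← Finset.mul_sum, if_pos rfl,
    show green G d o z [] = 0 from listFun_nil _] at h1
  linear_combination h1

theorem norm_listFun_le {o : V} (g : lp (fun _ : PathsFrom G o => ℂ) 2) {l : List V}
    (hl : IsRevPath G o l) : ‖listFun g l‖ ≤ ‖g‖ := by
  obtain ⟨P, rfl⟩ := exists_revSupport_iff.mpr hl
  rw [listFun_revSupport]
  exact lp.norm_apply_le_norm (by simp) g P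

theorem norm_green_le {o : V} {z : ℂ} (hz : z.im ≠ 0) {l : List V} (hl : IsRevPath G o l) :
    ‖green G d o z l‖ ≤ 1 / |z.im| := by
  refine (norm_listFun_le G _ hl).trans ?_
  have := norm_resolvent_apply_le (isSelfAdjoint_adjacencyOperator (pathTree G o) d) hz
    (chi (trivialPath G o))
  rwa [norm_chi] at this

theorem differentiableAt_green {o : V} {z : ℂ} (hz : z.im ≠ 0) {l : List V}
    (hl : IsRevPath G o l) : DifferentiableAt ℂ (fun z => green G d o z l) z := by
  obtain ⟨P, rfl⟩ := exists_revSupport_iff.mpr hl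
  have h1 := (spectrum.hasDerivAt_resolvent_const_left (mem_resolventSet_of_im_ne_zero
    (isSelfAdjoint_adjacencyOperator (pathTree G o) d) hz)).differentiableAt
  have h2 : (fun z => green G d o z (revSupport P)) = fun z => innerSL ℂ (chi P)
      (resolvent (adjacencyOperator (pathTree G o) d) z (chi (trivialPath G o))) := by
    funext z
    rw [green, listFun_revSupport, innerSL_apply_apply, inner_chi]
  rw [h2]
  exact (innerSL ℂ (chi P)).differentiableAt.comp z
    (h1.clm_apply (differentiableAt_const _))

/-- The limit at an atom of the green function is an eigenvector of the path tree. -/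
theorem exists_eigenvector (o : V) (θ : ℝ) : ∃ f : lp (fun _ : PathsFrom G o => ℂ) 2,
    adjacencyOperator (pathTree G o) d f = (θ : ℂ) • f ∧
    (∀ g, adjacencyOperator (pathTree G o) d g = (θ : ℂ) • g →
      ⟪g, f⟫_ℂ = ⟪g, chi (trivialPath G o)⟫_ℂ) ∧
    listFun f [o] = ((matchingMeasure G d o).real {θ} : ℂ) ∧
    ∀ l, IsRevPath G o l → Tendsto (fun ε : ℝ => Complex.I * ε * green G d o (θ + Complex.I * ε) l)
      (𝓝[>] 0) (𝓝 (listFun f l)) := by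
  have hA := isSelfAdjoint_adjacencyOperator (pathTree G o) d
  obtain ⟨f, h1, h2, h3, h4⟩ := exists_eigenvector_of_isSpectralMeasure hA
    (isMatchingMeasure_matchingMeasure G d o) θ
  refine ⟨f, h1, h2, ?_, fun l hl => ?_⟩
  · rw [← h3, inner_chi, ← listFun_revSupport, revSupport_trivialPath]
  · obtain ⟨P, rfl⟩ := exists_revSupport_iff.mpr hl
    have h5 := tendsto_smul_resolvent hA θ h1 h4
    have h6 := ((innerSL ℂ (chi P)).continuous.tendsto f).comp h5
    simp only [innerSL_apply_apply, inner_chi] at h6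
    rw [listFun_revSupport]
    refine h6.congr fun ε => ?_
    simp [green, listFun_revSupport, inner_chi]

end Green

/-! ### Contraction estimate for the defect of symmetry -/

section Symmetry

variable {V : Type u}

open Classical in
/-- One contraction step for the symmetry of iterated vertex deletion. -/
theorem norm_swap_sub_le {N : V → Finset V} (hsymm : ∀ a b, b ∈ N a ↔ a ∈ N b)
    (hirr : ∀ a, a ∉ N a) {d : ℕ} (hN : ∀ a, (N a).card ≤ d) {z : ℂ} {Y : ℝ}
    (hY : 7 * ((d : ℝ) + 1) ≤ Y) (hz : ‖z‖ ≤ 2 * Y) {R : Set V → V → ℂ}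
    (hrec : ∀ U o, o ∉ U → R U o * (z - ∑ v ∈ N o with v ∉ U, R (insert o U) v) = 1)
    (hR : ∀ U o, o ∉ U → ‖R U o‖ ≤ 1 / Y) {δ : ℝ}
    (hδ : ∀ U u v, u ∉ U → v ∉ U → u ≠ v →
      ‖R U u * R (insert u U) v - R U v * R (insert v U) u‖ ≤ δ)
    (U : Set V) (u v : V) (hu : u ∉ U) (hv : v ∉ U) (huv : u ≠ v) :
    ‖R U u * R (insert u U) v - R U v * R (insert v U) u‖ ≤ δ / 2 := by
  have hd0 : (0 : ℝ) ≤ d := Nat.cast_nonneg d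
  have hY0 : 0 < Y := by linarith
  have hδ0 : 0 ≤ δ := (norm_nonneg _).trans (hδ U u v hu hv huv)
  have hne : ∀ U o, o ∉ U → R U o ≠ 0 := fun U o ho h => by
    have := hrec U o ho
    rw [h, zero_mul] at this
    exact zero_ne_one this
  have hinv : ∀ U o, o ∉ U → (R U o)⁻¹ = z - ∑ v ∈ N o with v ∉ U, R (insert o U) v :=
    fun U o ho => inv_eq_of_mul_eq_one_right (hrec U o ho)
  -- By the recursion, |1/R| ≤ |z| + d/Y ≤ 2Y + Y.
  have hinvle : ∀ U o, o ∉ U → ‖(R U o)⁻¹‖ ≤ 3 * Y := by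
    intro U o ho
    rw [hinv U o ho]
    have h1 : ‖∑ v ∈ N o with v ∉ U, R (insert o U) v‖ ≤ d * (1 / Y) := by
      calc _ ≤ ∑ v ∈ N o with v ∉ U, ‖R (insert o U) v‖ := norm_sum_le _ _
        _ ≤ ∑ v ∈ N o with v ∉ U, 1 / Y := by
          refine Finset.sum_le_sum fun w hw => hR _ _ ?_
          rw [Finset.mem_filter] at hw
          rw [Set.mem_insert_iff, not_or]
          refine ⟨?_, hw.2⟩
          rintro rfl
          exact hirr _ hw.1
        _ = ((N o).filter (· ∉ U)).card * (1 / Y) := by rw [Finset.sum_const, nsmul_eq_mul]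
        _ ≤ d * (1 / Y) := by
          gcongr
          exact (Finset.card_filter_le _ _).trans (hN o)
    have h2 : (d : ℝ) * (1 / Y) ≤ Y := by
      rw [mul_one_div, div_le_iff₀ hY0]
      nlinarith
    linarith [norm_sub_le z (∑ v ∈ N o with v ∉ U, R (insert o U) v)]
  -- the expansion of `(R U v * R (insert v U) u)⁻¹`
  have expand : ∀ u v, u ∉ U → v ∉ U → u ≠ v → ∀ K, K = insert u (insert v U) →
      (R U v * R (insert v U) u)⁻¹ = z * (z - ∑ y ∈ N u with y ∉ K, R K y) -
        (if u ∈ N v then 1 else 0) - ∑ y ∈ N v with y ∉ K,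
          (R K y * (z - ∑ y' ∈ N u with y' ∉ K, if y' = y then 0 else R (insert y K) y') +
          (R (insert v U) y * R (insert y (insert v U)) u -
            R (insert v U) u * R K y) *
          ((R (insert v U) u)⁻¹ * (R (insert y (insert v U)) u)⁻¹)) := by
    intro u v hu hv huv K hKd
    have hu' : u ∉ insert v U := by simp [huv, hu]
    have hb0 := hne _ _ hu'
    have hb : (R (insert v U) u)⁻¹ = z - ∑ y ∈ N u with y ∉ K, R K y := by
      rw [hinv _ _ hu', ← hKd]
      congr 1
      refine Finset.sum_congr ?_ fun _ _ => rfl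
      ext y
      have : y ∈ N u → y ≠ u := by rintro h rfl; exact hirr _ h
      simp only [Finset.mem_filter, hKd, Set.mem_insert_iff]
      tauto
    have hsv : ∑ y ∈ N v with y ∉ U, R (insert v U) y =
        (if u ∈ N v then R (insert v U) u else 0) + ∑ y ∈ N v with y ∉ K, R (insert v U) y := by
      have h1 : (N v).filter (· ∉ U) = (N v).filter (fun y => y = u) ∪ (N v).filter (· ∉ K) := by
        ext y
        have : y ∈ N v → y ≠ v := by rintro h rfl; exact hirr _ h
        simp only [Finset.mem_filter, hKd, Set.mem_insert_iff, Finset.mem_union]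
        constructor
        · tauto
        · rintro (⟨h, rfl⟩ | h) <;> tauto
      rw [h1, Finset.sum_union]
      · congr 1
        rw [Finset.sum_filter]
        simp
      · rw [Finset.disjoint_filter]
        rintro y _ rfl
        simp [hKd]
    rw [mul_inv, hinv U v hv, hsv]
    -- The first summand is what an exact swap of y and u in G - U - v would give; the second
    -- carries the defect of that swap.
    have hterm : ∀ y ∈ (N v).filter (· ∉ K),
        R (insert v U) y * (R (insert v U) u)⁻¹ =
        R K y * (z - ∑ y' ∈ N u with y' ∉ K, if y' = y then 0 else R (insert y K) y') +
          (R (insert v U) y * R (insert y (insert v U)) u - R (insert v U) u * R K y) *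
          ((R (insert v U) u)⁻¹ * (R (insert y (insert v U)) u)⁻¹) := by
      intro y hy
      rw [Finset.mem_filter] at hy
      have hyu : y ≠ u := fun h => hy.2 (by simp [h, hKd])
      have huy : u ∉ insert y (insert v U) := by
        simp only [Set.mem_insert_iff, not_or] at hu' ⊢
        exact ⟨hyu.symm, hu'⟩
      have hc0 := hne _ _ huy
      have h1 : z - ∑ y' ∈ N u with y' ∉ K, (if y' = y then 0 else R (insert y K) y') =
          (R (insert y (insert v U)) u)⁻¹ := by
        rw [hinv _ _ huy, Set.insert_comm u y, ← hKd]
        congr 1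
        rw [Finset.sum_congr rfl fun w _ => (ite_not (w = y) (R (insert y K) w) 0).symm,
          ← Finset.sum_filter, Finset.filter_filter]
        refine Finset.sum_congr ?_ fun _ _ => rfl
        ext w
        have : w ∈ N u → w ≠ u := by rintro h rfl; exact hirr _ h
        simp only [Finset.mem_filter, hKd, Set.mem_insert_iff]
        tauto
      rw [h1]
      field_simp
      ring
    have hs := Finset.sum_congr rfl hterm
    rw [← Finset.sum_mul] at hs
    have : (if u ∈ N v then R (insert v U) u else 0) * (R (insert v U) u)⁻¹ =
        if u ∈ N v then 1 else 0 := by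
      split_ifs
      · exact mul_inv_cancel₀ hb0
      · simp
    linear_combination z * hb - this - hs
  obtain ⟨K, hK⟩ : ∃ K, K = insert u (insert v U) := ⟨_, rfl⟩
  have hK' : K = insert v (insert u U) := hK.trans (Set.insert_comm _ _ _)
  have hu' : u ∉ insert v U := by simp [huv, hu]
  have hv' : v ∉ insert u U := by simp [huv.symm, hv]
  have e1 := expand u v hu hv huv K hK
  have e2 := expand v u hv hu huv.symm K hK'
  have errle : ∀ u v, u ∉ U → v ∉ U → u ≠ v → K = insert u (insert v U) →
      ‖∑ y ∈ N v with y ∉ K, (R (insert v U) y * R (insert y (insert v U)) u -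
            R (insert v U) u * R K y) *
          ((R (insert v U) u)⁻¹ * (R (insert y (insert v U)) u)⁻¹)‖ ≤ d * (δ * (9 * Y ^ 2)) := by
    intro u v hu hv huv hKuv
    have hu' : u ∉ insert v U := by simp [huv, hu]
    calc _ ≤ ∑ y ∈ N v with y ∉ K, δ * (9 * Y ^ 2) := by
          refine norm_sum_le_of_le _ fun y hy => ?_
          rw [Finset.mem_filter, hKuv] at hy
          have hyu : y ≠ u := fun h => hy.2 (by simp [h])
          have hyv : y ∉ insert v U := fun h => hy.2 (Set.mem_insert_of_mem _ h)
          have huy : u ∉ insert y (insert v U) := by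
            simp only [Set.mem_insert_iff, not_or] at hu' ⊢
            exact ⟨hyu.symm, hu'⟩
          rw [norm_mul, norm_mul]
          refine mul_le_mul ?_ ?_ (by positivity) hδ0
          · rw [hKuv]
            exact hδ _ _ _ hyv hu' hyu
          · calc _ ≤ (3 * Y) * (3 * Y) :=
                  mul_le_mul (hinvle _ _ hu') (hinvle _ _ huy) (norm_nonneg _) (by positivity)
              _ = _ := by ring
      _ = ((N v).filter (· ∉ K)).card * (δ * (9 * Y ^ 2)) := by
          rw [Finset.sum_const, nsmul_eq_mul]
      _ ≤ _ := by
          gcongr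
          exact (Finset.card_filter_le _ _).trans (hN v)
  -- Exchanging u and v antisymmetrizes the double sum, and its terms become swap defects of y and
  -- y' in G - K.
  have hmain : ‖∑ y ∈ N v with y ∉ K, ∑ y' ∈ N u with y' ∉ K,
      (if y' = y then 0 else R K y * R (insert y K) y' - R K y' * R (insert y' K) y)‖ ≤
      d * (d * δ) := by
    calc _ ≤ ∑ y ∈ N v with y ∉ K, (d : ℝ) * δ := by
          refine norm_sum_le_of_le _ fun y hy => ?_
          calc _ ≤ ∑ y' ∈ N u with y' ∉ K, δ := by
                refine norm_sum_le_of_le _ fun y' hy' => ?_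
                rw [Finset.mem_filter] at hy hy'
                split_ifs with h
                · simpa using hδ0
                · exact hδ K y y' hy.2 hy'.2 (Ne.symm h)
            _ = ((N u).filter (· ∉ K)).card * δ := by rw [Finset.sum_const, nsmul_eq_mul]
            _ ≤ _ := by
                gcongr
                exact (Finset.card_filter_le _ _).trans (hN u)
      _ = ((N v).filter (· ∉ K)).card * (d * δ) := by rw [Finset.sum_const, nsmul_eq_mul]
      _ ≤ _ := by
          gcongr
          exact (Finset.card_filter_le _ _).trans (hN v)
  have r1 := errle u v hu hv huv hK
  have r2 := errle v u hv hu huv.symm hK'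
  set E1 := ∑ y ∈ N v with y ∉ K, (R (insert v U) y * R (insert y (insert v U)) u -
            R (insert v U) u * R K y) *
          ((R (insert v U) u)⁻¹ * (R (insert y (insert v U)) u)⁻¹) with hE1
  set E2 := ∑ y ∈ N u with y ∉ K, (R (insert u U) y * R (insert y (insert u U)) v -
            R (insert u U) v * R K y) *
          ((R (insert u U) v)⁻¹ * (R (insert y (insert u U)) v)⁻¹) with hE2
  set M := ∑ y ∈ N v with y ∉ K, ∑ y' ∈ N u with y' ∉ K,
      (if y' = y then 0 else R K y * R (insert y K) y' - R K y' * R (insert y' K) y) with hM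
  -- The parts of the two expansions that are symmetric in u and v cancel; only terms proportional
  -- to swap defects remain.
  have hdiff : (R U v * R (insert v U) u)⁻¹ - (R U u * R (insert u U) v)⁻¹ = M - E1 + E2 := by
    have hM' : M = ∑ y ∈ N v with y ∉ K, R K y * ∑ y' ∈ N u with y' ∉ K,
          (if y' = y then 0 else R (insert y K) y') -
        ∑ y' ∈ N u with y' ∉ K, R K y' * ∑ y ∈ N v with y ∉ K,
          (if y = y' then 0 else R (insert y' K) y) := by
      simp only [Finset.mul_sum]
      rw [Finset.sum_comm (s := (N u).filter (· ∉ K)), ← Finset.sum_sub_distrib, hM]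
      refine Finset.sum_congr rfl fun y _ => ?_
      rw [← Finset.sum_sub_distrib]
      refine Finset.sum_congr rfl fun y' _ => ?_
      by_cases h : y' = y
      · simp [h]
      · simp [h, Ne.symm h]
    have hite : (if u ∈ N v then (1 : ℂ) else 0) = if v ∈ N u then 1 else 0 := by
      simp only [hsymm v u]
    have hmul : ∀ (S : Finset V) (g : V → ℂ), ∑ y ∈ S, R K y * (z - g y) =
        (∑ y ∈ S, R K y) * z - ∑ y ∈ S, R K y * g y := fun S g => by
      simp only [mul_sub, Finset.sum_sub_distrib, ← Finset.sum_mul]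
    rw [e1, e2, Finset.sum_add_distrib, Finset.sum_add_distrib, hM', hite, hmul, hmul, ← hE1, ← hE2]
    ring
  have hfin : R U u * R (insert u U) v - R U v * R (insert v U) u =
      (R U u * R (insert u U) v) * (R U v * R (insert v U) u) * (M - E1 + E2) := by
    rw [← hdiff]
    have := hne _ _ hu
    have := hne _ _ hv
    have := hne _ _ hu'
    have := hne _ _ hv'
    field_simp
  have hprod : ‖(R U u * R (insert u U) v) * (R U v * R (insert v U) u)‖ ≤
      (1 / Y * (1 / Y)) * (1 / Y * (1 / Y)) := by
    rw [norm_mul, norm_mul, norm_mul]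
    have := hR _ _ hu
    have := hR _ _ hv
    have := hR _ _ hu'
    have := hR _ _ hv'
    gcongr
  have hsum : ‖M - E1 + E2‖ ≤ δ * (d ^ 2 + 18 * d * Y ^ 2) := by
    calc _ ≤ ‖M‖ + ‖E1‖ + ‖E2‖ :=
          (norm_add_le _ _).trans (add_le_add_left (norm_sub_le _ _) _)
      _ ≤ _ := by linarith
  rw [hfin, norm_mul]
  calc _ ≤ (1 / Y * (1 / Y)) * (1 / Y * (1 / Y)) * (δ * (d ^ 2 + 18 * d * Y ^ 2)) :=
        mul_le_mul hprod hsum (norm_nonneg _) (by positivity)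
    _ = δ * ((d ^ 2 + 18 * d * Y ^ 2) / Y ^ 4) := by field_simp
    _ ≤ δ * (1 / 2) := by
        refine mul_le_mul_of_nonneg_left ?_ hδ0
        rw [div_le_iff₀ (by positivity)]
        -- The constant 7 is ample for d² + 18dY² ≤ Y⁴/2, where 18 = 2 · 9 comes from the two error
        -- sums.
        have h1 : (49 * (d + 1) ^ 2 : ℝ) ≤ Y ^ 2 := by nlinarith
        have h2 : (d : ℝ) ^ 2 ≤ Y ^ 2 := by nlinarith
        nlinarith [sq_nonneg Y]
    _ = δ / 2 := by ring

end Symmetry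

/-! ### Ratios, their symmetry, and products along lists -/

section Ratio

variable {V : Type u} (G : SimpleGraph V) (d : ℕ) [DegreeAtMost G d]

theorem green_congr {G G' : SimpleGraph V} {d : ℕ} [DegreeAtMost G d] [DegreeAtMost G' d]
    (h : G = G') (o : V) (z : ℂ) : green G d o z = green G' d o z := by
  subst h; rfl

theorem matchingMeasure_congr {G G' : SimpleGraph V} {d : ℕ} [DegreeAtMost G d]
    [DegreeAtMost G' d] (h : G = G') (o : V) : matchingMeasure G d o = matchingMeasure G' d o := by
  subst h; rfl

/-- The analogue of the quotient of the matching polynomials of `G - U - o` and `G - U`. -/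
noncomputable def ratio (U : Set V) (o : V) (z : ℂ) : ℂ := green (del G U) d o z [o]

/-- The analogue of the quotient of the matching polynomials of `G - U - L` and `G - U`. -/
noncomputable def listRatio : Set V → List V → ℂ → ℂ
  | _, [], _ => 1
  | U, v :: L, z => ratio G d U v z * listRatio (insert v U) L z

theorem green_del_del (U : Set V) (u v : V) (z : ℂ) :
    green (del (del G U) {u}) d v z = green (del G (insert u U)) d v z :=
  green_congr (by rw [del_del, Set.union_singleton]) v z

open Classical in
theorem ratio_mul_eq_one {U : Set V} {o : V} (ho : o ∉ U) {z : ℂ} (hz : z.im ≠ 0) :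
    ratio G d U o z * (z - ∑ v ∈ nbrs G d o with v ∉ U, ratio G d (insert o U) v z) = 1 := by
  have h := green_root (del G U) d (o := o) hz
  have hs : nbrs (del G U) d o = (nbrs G d o).filter (· ∉ U) := by
    ext w; simp [del_adj, ho]
  simp only [green_del_del, hs] at h
  exact h

theorem norm_ratio_le {U : Set V} {o : V} {z : ℂ} (hz : z.im ≠ 0) :
    ‖ratio G d U o z‖ ≤ 1 / |z.im| := norm_green_le (del G U) d hz IsRevPath.singleton

theorem ratio_ne_zero {U : Set V} {o : V} (ho : o ∉ U) {z : ℂ} (hz : z.im ≠ 0) :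
    ratio G d U o z ≠ 0 := left_ne_zero_of_mul_eq_one (ratio_mul_eq_one G d ho hz)

open Classical in
theorem inv_ratio {U : Set V} {o : V} (ho : o ∉ U) {z : ℂ} (hz : z.im ≠ 0) :
    (ratio G d U o z)⁻¹ = z - ∑ v ∈ nbrs G d o with v ∉ U, ratio G d (insert o U) v z :=
  inv_eq_of_mul_eq_one_right (ratio_mul_eq_one G d ho hz)

theorem differentiableAt_ratio {U : Set V} {o : V} {z : ℂ} (hz : z.im ≠ 0) :
    DifferentiableAt ℂ (ratio G d U o) z :=
  differentiableAt_green (del G U) d hz IsRevPath.singleton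

/-- All defects are at most 2/Y² a priori, uniformly in U, u and v, and each use of
`norm_swap_sub_le` halves the common bound. -/
theorem ratio_swap_of_large {z : ℂ} {Y : ℝ} (hY : 7 * ((d : ℝ) + 1) ≤ Y) (hz : ‖z‖ ≤ 2 * Y)
    (him : Y ≤ z.im) {U : Set V} {u v : V} (hu : u ∉ U) (hv : v ∉ U) (huv : u ≠ v) :
    ratio G d U u z * ratio G d (insert u U) v z =
      ratio G d U v z * ratio G d (insert v U) u z := by
  have hd0 : (0 : ℝ) ≤ d := Nat.cast_nonneg d
  have hY0 : 0 < Y := by linarith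
  have hz0 : z.im ≠ 0 := by linarith
  have hR : ∀ U o, ‖ratio G d U o z‖ ≤ 1 / Y := by
    intro U o
    refine (norm_ratio_le G d hz0).trans ?_
    rw [abs_of_pos (by linarith)]
    gcongr
  have key : ∀ n : ℕ, ∀ U u v, u ∉ U → v ∉ U → u ≠ v →
      ‖ratio G d U u z * ratio G d (insert u U) v z -
        ratio G d U v z * ratio G d (insert v U) u z‖ ≤ 2 * (1 / Y * (1 / Y)) * (1 / 2) ^ n := by
    intro n
    induction n with
    | zero =>
      intro U u v _ _ _
      have h : ∀ U u W v, ‖ratio G d U u z * ratio G d W v z‖ ≤ 1 / Y * (1 / Y) := by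
        intro U u W v
        rw [norm_mul]
        have := hR U u
        have := hR W v
        gcongr
      have := norm_sub_le (ratio G d U u z * ratio G d (insert u U) v z)
        (ratio G d U v z * ratio G d (insert v U) u z)
      linarith [h U u (insert u U) v, h U v (insert v U) u]
    | succ n ih =>
      intro U u v hu hv huv
      have := norm_swap_sub_le (N := nbrs G d) (fun a b => by simp [G.adj_comm]) (by simp)
        (card_nbrs_le G d) hY hz (R := fun U o => ratio G d U o z)
        (fun U o ho => ratio_mul_eq_one G d ho hz0) (fun U o _ => hR U o) ih U u v hu hv huv
      refine this.trans (le_of_eq ?_)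
      rw [pow_succ]
      ring
  have hlim : Tendsto (fun n : ℕ => 2 * (1 / Y * (1 / Y)) * (1 / 2 : ℝ) ^ n) atTop (𝓝 0) := by
    have := (tendsto_pow_atTop_nhds_zero_of_lt_one (by norm_num : (0 : ℝ) ≤ 1 / 2)
      (by norm_num)).const_mul (2 * (1 / Y * (1 / Y)))
    simpa using this
  have := ge_of_tendsto' hlim fun n => key n U u v hu hv huv
  exact sub_eq_zero.mp (norm_le_zero_iff.mp this)

/-- Iterated vertex deletion is symmetric. -/
theorem ratio_swap {z : ℂ} (hz : 0 < z.im) {U : Set V} {u v : V} (hu : u ∉ U) (hv : v ∉ U)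
    (huv : u ≠ v) :
    ratio G d U u z * ratio G d (insert u U) v z =
      ratio G d U v z * ratio G d (insert v U) u z := by
  set S : Set ℂ := {z | 0 < z.im} with hS
  have hSo : IsOpen S := isOpen_lt continuous_const Complex.continuous_im
  have hSc : IsPreconnected S := (convex_halfSpace_im_gt 0).isPreconnected
  have han : ∀ U u W v, AnalyticOnNhd ℂ (fun z => ratio G d U u z * ratio G d W v z) S := by
    intro U u W v
    refine DifferentiableOn.analyticOnNhd (fun z hz => ?_) hSo
    have hz0 : z.im ≠ 0 := ne_of_gt hz
    exact ((differentiableAt_ratio G d hz0).mul (differentiableAt_ratio G d hz0)).differentiableWithinAt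
  set Y : ℝ := 7 * ((d : ℝ) + 1) with hY
  have hY0 : 0 < Y := by positivity
  -- The point 3Yi/2 is interior to the region Y ≤ Im z, |z| ≤ 2Y of the contraction estimate.
  have hw : (Complex.I * (3 / 2 * Y : ℝ)) ∈ S := by
    simp [hS]; positivity
  refine (han U u (insert u U) v).eqOn_of_preconnected_of_eventuallyEq
    (han U v (insert v U) u) hSc hw ?_ hz
  have h1 : ∀ᶠ z : ℂ in 𝓝 (Complex.I * (3 / 2 * Y : ℝ)), ‖z‖ < 2 * Y := by
    refine (continuous_norm.tendsto _).eventually_lt_const ?_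
    rw [norm_mul, Complex.norm_I, Complex.norm_real, Real.norm_eq_abs, abs_of_pos (by positivity)]
    linarith
  have h2 : ∀ᶠ z : ℂ in 𝓝 (Complex.I * (3 / 2 * Y : ℝ)), Y < z.im := by
    refine (Complex.continuous_im.tendsto _).eventually_const_lt ?_
    simp only [Complex.mul_im, Complex.I_re, Complex.I_im, Complex.ofReal_re, Complex.ofReal_im]
    linarith
  filter_upwards [h1, h2] with z hz1 hz2
  exact ratio_swap_of_large G d le_rfl hz1.le hz2.le hu hv huv

theorem listRatio_append (U : Set V) (L L' : List V) (z : ℂ) :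
    listRatio G d U (L ++ L') z =
      listRatio G d U L z * listRatio G d (U ∪ {x | x ∈ L}) L' z := by
  induction L generalizing U with
  | nil => simp [listRatio]
  | cons v L ih =>
    have : insert v U ∪ {x | x ∈ L} = U ∪ {x | x ∈ v :: L} := by
      ext x; simp only [Set.mem_union, Set.mem_insert_iff, Set.mem_ofPred_eq, List.mem_cons]; tauto
    rw [List.cons_append, listRatio, listRatio, ih, this, mul_assoc]

/-- Adjacent transpositions are instances of `ratio_swap`: the cost of deleting a set does not
depend on the order of deletion. -/
theorem listRatio_perm {z : ℂ} (hz : 0 < z.im) {L L' : List V} (h : L.Perm L') (hn : L.Nodup)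
    {U : Set V} (hU : ∀ x ∈ L, x ∉ U) : listRatio G d U L z = listRatio G d U L' z := by
  induction h generalizing U with
  | nil => rfl
  | cons v _ ih =>
    rw [List.nodup_cons] at hn
    rw [listRatio, listRatio, ih hn.2]
    intro x hx
    rw [Set.mem_insert_iff, not_or]
    refine ⟨?_, hU x (by simp [hx])⟩
    rintro rfl
    exact hn.1 hx
  | swap u v L =>
    simp only [listRatio]
    rw [← mul_assoc, ← mul_assoc, ratio_swap G d hz (hU v (by simp)) (hU u (by simp)) ?_,
      Set.insert_comm]
    rintro rfl
    simp at hn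
  | trans h1 _ ih1 ih2 =>
    rw [ih1 hn hU]
    exact ih2 (h1.nodup_iff.mp hn) fun x hx => hU x (h1.mem_iff.mpr hx)

theorem listRatio_ne_zero {U : Set V} {L : List V} (hn : L.Nodup) (hU : ∀ x ∈ L, x ∉ U) {z : ℂ}
    (hz : z.im ≠ 0) : listRatio G d U L z ≠ 0 := by
  induction L generalizing U with
  | nil => exact one_ne_zero
  | cons v L ih =>
    rw [List.nodup_cons] at hn
    refine mul_ne_zero (ratio_ne_zero G d (hU v (by simp)) hz) (ih hn.2 fun x hx => ?_)
    rw [Set.mem_insert_iff, not_or]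
    refine ⟨?_, hU x (by simp [hx])⟩
    rintro rfl
    exact hn.1 hx

/-- The green function at a path is the product of the ratios along the path. -/
theorem green_reverse {U : Set V} {o : V} (ho : o ∉ U) {L : List V}
    (hL : IsRevPath (del G U) o (o :: L).reverse) {z : ℂ} (hz : z.im ≠ 0) :
    green (del G U) d o z (o :: L).reverse = listRatio G d U (o :: L) z := by
  induction L generalizing U o with
  | nil => simp [listRatio, ratio]
  | cons v L ih =>
    have hc := List.isChain_reverse.mp hL.1
    rw [List.isChain_cons_cons] at hc
    have hov : (del G U).Adj o v := hc.1.symm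
    have hn := List.nodup_reverse.mp hL.2.1
    have hlast : ((v :: L).reverse).getLast? = some v := by simp
    have h1 : IsRevPath (del (del G U) {o}) v (v :: L).reverse := by
      refine ⟨?_, List.nodup_reverse.mpr (List.nodup_cons.mp hn).2, hlast⟩
      rw [List.isChain_reverse]
      have hno : ∀ x ∈ v :: L, x ∉ ({o} : Set V) := by
        rintro x hx rfl
        exact (List.nodup_cons.mp hn).1 hx
      exact hc.2.imp_of_mem_imp fun a b ha hb hab => ⟨hab, hno b hb, hno a ha⟩
    have h2 := green_append_root (del G U) d hov hz h1
    have h3 : IsRevPath (del G (insert o U)) v (v :: L).reverse := by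
      rwa [del_del, Set.union_singleton] at h1
    have hv : v ∉ insert o U := by
      rw [Set.mem_insert_iff, not_or]
      exact ⟨hov.ne', (del_adj.mp hov).2.2⟩
    rw [List.reverse_cons, h2, green_del_del, ih hv h3]
    rfl

end Ratio

/-! ### Eigenvectors of path trees and their restriction to subgraphs -/

section Eigenvector

variable {V : Type u} (G : SimpleGraph V) (d : ℕ) [DegreeAtMost G d] (θ : ℝ)

theorem isEssential_iff_real_ne_zero {o : V} :
    IsEssential G d θ o ↔ (matchingMeasure G d o).real {θ} ≠ 0 := by
  have := (isMatchingMeasure_matchingMeasure G d o).isProbabilityMeasure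
  rw [IsEssential, pos_iff_ne_zero, measureReal_def, ENNReal.toReal_ne_zero]
  exact ⟨fun h => ⟨h, measure_ne_top _ _⟩, fun h => h.1⟩

theorem inner_chi_trivialPath {G : SimpleGraph V} {o : V}
    (k : lp (fun _ : PathsFrom G o => ℂ) 2) :
    ⟪k, chi (trivialPath G o)⟫_ℂ = (starRingEnd ℂ) (listFun k [o]) := by
  rw [← inner_conj_symm, inner_chi, ← listFun_revSupport, revSupport_trivialPath]

variable {G d θ} in
/-- A root of the path tree is essential as soon as some eigenvector does not vanish at it. -/
theorem isEssential_of_eigenvector {o : V} {g : lp (fun _ : PathsFrom G o => ℂ) 2}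
    (hg : adjacencyOperator (pathTree G o) d g = (θ : ℂ) • g) (h : listFun g [o] ≠ 0) :
    IsEssential G d θ o := by
  obtain ⟨f, h1, h2, h3, -⟩ := exists_eigenvector G d o θ
  rw [isEssential_iff_real_ne_zero]
  intro h0
  -- ‖f‖² = ⟨f, χ⟩ is the mass. If it is 0, the root vector is orthogonal to the whole θ-eigenspace.
  have hf : f = 0 := by
    have := h2 f h1
    rw [inner_chi_trivialPath, h3, h0] at this
    simpa using this
  have := h2 g hg
  rw [inner_chi_trivialPath, hf, inner_zero_right] at this
  exact h (by simpa using this.symm)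

variable {G d θ} in
open Classical in
theorem eigenvector_eq {o : V} {g : lp (fun _ : PathsFrom G o => ℂ) 2}
    (hg : adjacencyOperator (pathTree G o) d g = (θ : ℂ) • g) {x : V} {l : List V}
    (h : IsRevPath G o (x :: l)) :
    ∑ y ∈ nbrs G d x with y ∉ x :: l, listFun g (y :: x :: l) + listFun g l =
      θ * listFun g (x :: l) := by
  obtain ⟨P, hP⟩ := exists_revSupport_iff.mpr h
  rw [← adjacencyOperator_pathTree_apply d g P hP, hg, ← hP, listFun_revSupport]
  rfl

open Classical in
theorem eigenvector_of_eq {o : V} {g : lp (fun _ : PathsFrom G o => ℂ) 2}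
    (h : ∀ x l, IsRevPath G o (x :: l) →
      ∑ y ∈ nbrs G d x with y ∉ x :: l, listFun g (y :: x :: l) + listFun g l =
        θ * listFun g (x :: l)) :
    adjacencyOperator (pathTree G o) d g = (θ : ℂ) • g := by
  ext P
  obtain ⟨x, l, hP⟩ : ∃ x l, revSupport P = x :: l := ⟨_, _, revSupport_eq_cons P⟩
  have h1 := isRevPath_revSupport P
  rw [hP] at h1
  rw [adjacencyOperator_pathTree_apply d g P hP, h _ _ h1, ← hP, listFun_revSupport]
  rfl

variable {G θ} in
/-- An eigenvector of the path tree that vanishes at all paths ending in `Z` restricts to the path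
tree of a subgraph containing all the edges outside of `Z`. -/
theorem isEssential_of_restrict {W : Type*} {G' : SimpleGraph W} [DegreeAtMost G' d] {φ : W → V}
    (hφ : Function.Injective φ) {o : W} {Z : Set V}
    (hadj : ∀ a b, G'.Adj a b → G.Adj (φ a) (φ b) ∧ φ b ∉ Z)
    (hfull : ∀ a x, φ a ∉ Z → x ∉ Z → G.Adj (φ a) x → ∃ b, φ b = x ∧ G'.Adj a b)
    (ho : φ o ∉ Z) {f : lp (fun _ : PathsFrom G (φ o) => ℂ) 2}
    (hf : adjacencyOperator (pathTree G (φ o)) d f = (θ : ℂ) • f)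
    (hZ : ∀ x ∈ Z, ∀ l, IsRevPath G (φ o) (x :: l) → listFun f (x :: l) = 0)
    (h0 : listFun f [φ o] ≠ 0) : IsEssential G' d θ o := by
  classical
  have hrev : ∀ l, IsRevPath G' o l → IsRevPath G (φ o) (l.map φ) := fun l hl =>
    hl.map φ hφ fun a b hab => (hadj a b hab).1
  obtain ⟨g, hg⟩ := exists_pullback (ι := List.map φ) hφ.list_map hrev f
  refine isEssential_of_eigenvector (g := g) (eigenvector_of_eq G' d θ fun x l h => ?_) ?_
  · have hx : φ x ∉ Z := h.mem_of_closed (S := φ ⁻¹' Zᶜ) ho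
      (fun a _ b hab => (hadj a b hab).2) x (by simp)
    have h1 := eigenvector_eq hf (x := φ x) (l := l.map φ) (hrev _ h)
    rw [hg _ h, List.map_cons, ← h1]
    congr 1
    · have h2 : ((nbrs G' d x).filter (· ∉ x :: l)).image φ ⊆
          (nbrs G d (φ x)).filter (· ∉ φ x :: l.map φ) := by
        intro w hw
        simp only [Finset.mem_image, Finset.mem_filter, mem_nbrs] at hw ⊢
        obtain ⟨y, ⟨h3, h4⟩, rfl⟩ := hw
        refine ⟨(hadj _ _ h3).1, ?_⟩
        rw [← List.map_cons, List.mem_map_of_injective hφ]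
        exact h4
      -- The children missing from the smaller path tree end in Z, where f vanishes.
      rw [← Finset.sum_subset h2, Finset.sum_image hφ.injOn]
      · refine Finset.sum_congr rfl fun y hy => ?_
        rw [Finset.mem_filter, mem_nbrs] at hy
        rw [hg _ (h.cons hy.1 hy.2)]
        rfl
      · intro w hw hw'
        rw [Finset.mem_filter, mem_nbrs] at hw
        refine hZ w ?_ _ (IsRevPath.cons (hrev _ h) hw.1 hw.2)
        by_contra hwZ
        obtain ⟨b, rfl, hb⟩ := hfull x w hx hwZ hw.1
        refine hw' (Finset.mem_image_of_mem _ ?_)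
        rw [Finset.mem_filter, mem_nbrs]
        refine ⟨hb, ?_⟩
        rw [← List.mem_map_of_injective hφ, List.map_cons]
        exact hw.2
    · cases l with
      | nil => simp [listFun_nil]
      | cons y l => exact hg _ h.of_cons_cons.1
  · rw [hg _ IsRevPath.singleton]
    exact h0

end Eigenvector

/-! ### Inessential vertices and the proof of (a) -/

section Essential

variable {V : Type u} (G : SimpleGraph V) (d : ℕ) [DegreeAtMost G d] (θ : ℝ)

/-- The vertex `v` is `θ`-essential in `G - U`. -/
def EssentialIn (U : Set V) (v : V) : Prop := v ∉ U ∧ IsEssential (del G U) d θ v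

/-- The mass at `θ` of the matching measure of `G - U` with root `v`. -/
noncomputable def mass (U : Set V) (v : V) : ℝ := (matchingMeasure (del G U) d v).real {θ}

/-- The condition on v matters: `del` keeps the vertices of U as isolated vertices, which have mass
1 at θ = 0. -/
theorem essentialIn_iff {U : Set V} {v : V} (hv : v ∉ U) :
    EssentialIn G d θ U v ↔ mass G d θ U v ≠ 0 := by
  rw [EssentialIn, isEssential_iff_real_ne_zero]
  exact and_iff_right hv

theorem essentialIn_empty_iff {v : V} : EssentialIn G d θ ∅ v ↔ v ∈ essentialSet G d θ := by
  rw [EssentialIn, IsEssential, matchingMeasure_congr (del_empty G)]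
  simp [essentialSet, IsEssential]

theorem IsRevPath.reverse {G : SimpleGraph V} {o x : V} {l : List V}
    (h : IsRevPath G o (x :: l)) : IsRevPath G x (x :: l).reverse := by
  refine ⟨?_, List.nodup_reverse.mpr h.2.1, by simp⟩
  rw [List.isChain_reverse]
  exact h.1.imp fun a b hab => hab.symm

/-- f is the projection of the root vector, hence the limit of iε times the Green function. By
`green_reverse` and `listRatio_perm`, the Green function at a path from w to x equals the one at the
reversed path in the tree rooted at x. The latter limit is an entry of the projection of the root
vector at x, which is zero when x is inessential. -/
theorem exists_eigenvector_vanishing {U : Set V} {w : V} (hw : EssentialIn G d θ U w) :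
    ∃ f : lp (fun _ : PathsFrom (del G U) w => ℂ) 2,
      adjacencyOperator (pathTree (del G U) w) d f = (θ : ℂ) • f ∧ listFun f [w] ≠ 0 ∧
      ∀ x, ¬ EssentialIn G d θ U x → ∀ l, IsRevPath (del G U) w (x :: l) →
        listFun f (x :: l) = 0 := by
  obtain ⟨f, h1, -, h3, h4⟩ := exists_eigenvector (del G U) d w θ
  refine ⟨f, h1, ?_, fun x hx l hl => ?_⟩
  · rw [h3]
    exact_mod_cast (isEssential_iff_real_ne_zero _ d θ).mp hw.2
  have hU := hl.notMem_of_del hw.1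
  obtain ⟨g, k1, k2, k3, k4⟩ := exists_eigenvector (del G U) d x θ
  have hg : g = 0 := by
    have hm : mass G d θ U x = 0 := by
      by_contra h
      exact hx ((essentialIn_iff G d θ (hU x (by simp))).mpr h)
    have := k2 g k1
    rw [inner_chi_trivialPath, k3] at this
    change _ = (starRingEnd ℂ) ((mass G d θ U x : ℝ) : ℂ) at this
    rw [hm] at this
    simpa using this
  have h5 := k4 _ hl.reverse
  have h6 : listFun g (x :: l).reverse = 0 := by
    obtain ⟨P, hP⟩ := exists_revSupport_iff.mpr hl.reverse
    rw [← hP, listFun_revSupport, hg]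
    rfl
  rw [h6] at h5
  refine tendsto_nhds_unique (h4 _ hl) (h5.congr' ?_)
  filter_upwards [self_mem_nhdsWithin] with ε hε
  have hz : 0 < ((θ : ℂ) + Complex.I * ε).im := by simpa using hε
  congr 1
  rw [green_reverse G d (hU x (by simp)) hl.reverse hz.ne']
  obtain ⟨o, L, hoL⟩ : ∃ o L, (x :: l).reverse = o :: L :=
    List.exists_cons_of_ne_nil (by simp)
  have hxl : x :: l = (o :: L).reverse := by rw [← hoL, List.reverse_reverse]
  have how : o = w := by
    have := hl.2.2
    rw [hxl] at this
    simpa using this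
  subst how
  rw [hxl] at hl
  have h7 := green_reverse G d hw.1 hl hz.ne'
  rw [hxl, h7]
  have hp : (o :: L).Perm (o :: L).reverse := (List.reverse_perm _).symm
  refine (listRatio_perm G d hz hp ?_ ?_).symm
  · exact List.nodup_reverse.mp hl.2.1
  · intro y hy
    refine hU y ?_
    rw [hxl]
    exact List.mem_reverse.mpr hy

/-- Deleting non-essential vertices preserves essential vertices. -/
theorem EssentialIn.union {U B : Set V} {w : V} (hw : EssentialIn G d θ U w)
    (hB : ∀ x ∈ B, ¬ EssentialIn G d θ U x) : EssentialIn G d θ (U ∪ B) w := by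
  obtain ⟨f, h1, h2, h3⟩ := exists_eigenvector_vanishing G d θ hw
  have hwB : w ∉ U ∪ B := by
    rintro (h | h)
    · exact hw.1 h
    · exact hB w h hw
  refine ⟨hwB, isEssential_of_restrict d (φ := id) Function.injective_id (Z := U ∪ B)
    (G := del G U) ?_ ?_ hwB h1 ?_ h2⟩
  · intro a b hab
    exact ⟨⟨hab.1, fun h => hab.2.1 (Or.inl h), fun h => hab.2.2 (Or.inl h)⟩, hab.2.2⟩
  · intro a x ha hx hax
    exact ⟨x, rfl, hax.1, ha, hx⟩
  · rintro x hx l hl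
    refine h3 x ?_ l hl
    rcases hx with hx | hx
    · exact fun h => h.1 hx
    · exact hB x hx

/-- The connected components of the graph induced on the essential vertices are critical. -/
theorem isCritical_component (c : (G.induce (essentialSet G d θ)).ConnectedComponent) :
    IsCritical c.toSimpleGraph d θ := by
  intro w
  have hw : EssentialIn G d θ ∅ w.1.1 := (essentialIn_empty_iff G d θ).mpr w.1.2
  obtain ⟨f, h1, h2, h3⟩ := exists_eigenvector_vanishing G d θ hw
  -- With Z the set of inessential vertices, an edge from the component to a vertex outside Z stays
  -- in the component.
  refine isEssential_of_restrict d (φ := fun a : c => a.1.1)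
    (Subtype.val_injective.comp Subtype.val_injective) (Z := (essentialSet G d θ)ᶜ)
    (G := del G ∅) ?_ ?_ (by simp) h1 ?_ h2
  · intro a b hab
    exact ⟨⟨hab, by simp, by simp⟩, by simp⟩
  · intro a x ha hx hax
    rw [Set.notMem_compl_iff] at hx
    have hadj : (G.induce (essentialSet G d θ)).Adj a.1 ⟨x, hx⟩ := hax.1
    exact ⟨⟨⟨x, hx⟩, c.mem_supp_of_adj_mem_supp a.2 hadj⟩, rfl, hax.1⟩
  · intro x hx l hl
    exact h3 x (fun h => hx ((essentialIn_empty_iff G d θ).mp h)) l hl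

end Essential

/-! ### Growth of ratios at θ and Gallai's lemma -/

section Asymptotics

variable {V : Type u} (G : SimpleGraph V) (d : ℕ) [DegreeAtMost G d] (θ : ℝ)

theorem im_pos_of_pos {ε : ℝ} (hε : 0 < ε) : 0 < ((θ : ℂ) + Complex.I * ε).im := by simpa using hε

theorem I_mul_ne_zero {ε : ℝ} (hε : 0 < ε) : Complex.I * (ε : ℂ) ≠ 0 := by simp [hε.ne']

theorem tendsto_I_mul : Tendsto (fun ε : ℝ => Complex.I * (ε : ℂ)) (𝓝[>] 0) (𝓝 0) := by
  have : Tendsto (fun ε : ℝ => Complex.I * (ε : ℂ)) (𝓝 0) (𝓝 (Complex.I * ((0 : ℝ) : ℂ))) :=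
    Continuous.tendsto (by fun_prop) 0
  simp only [Complex.ofReal_zero, mul_zero] at this
  exact this.mono_left nhdsWithin_le_nhds

theorem tendsto_ratio (U : Set V) (v : V) :
    Tendsto (fun ε : ℝ => Complex.I * ε * ratio G d U v (θ + Complex.I * ε)) (𝓝[>] 0)
      (𝓝 (mass G d θ U v : ℂ)) := by
  obtain ⟨f, -, -, h3, h4⟩ := exists_eigenvector (del G U) d v θ
  have := h4 [v] IsRevPath.singleton
  rwa [h3] at this

open Classical in
/-- The total mass at `θ` of the neighbours of `v` in `G - U - v`. -/
noncomputable def comass (U : Set V) (v : V) : ℝ :=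
  ∑ y ∈ nbrs G d v with y ∉ U, mass G d θ (insert v U) y

/-- In the continued fraction for 1/R the factor iε kills the term z and turns the ratios at the
neighbours into their masses. -/
theorem tendsto_inv_ratio {U : Set V} {v : V} (hv : v ∉ U) :
    Tendsto (fun ε : ℝ => Complex.I * ε * (ratio G d U v (θ + Complex.I * ε))⁻¹) (𝓝[>] 0)
      (𝓝 (-(comass G d θ U v : ℂ))) := by
  classical
  have h1 : Tendsto (fun ε : ℝ => Complex.I * ε * (θ + Complex.I * ε) -
      ∑ y ∈ nbrs G d v with y ∉ U,
        Complex.I * ε * ratio G d (insert v U) y (θ + Complex.I * ε)) (𝓝[>] 0)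
      (𝓝 (0 * (θ + 0) - ∑ y ∈ nbrs G d v with y ∉ U, (mass G d θ (insert v U) y : ℂ))) :=
    (tendsto_I_mul.mul (tendsto_const_nhds.add tendsto_I_mul)).sub
      (tendsto_finsetSum _ fun y _ => tendsto_ratio G d θ _ y)
  have h2 : (0 * (θ + 0) - ∑ y ∈ nbrs G d v with y ∉ U, (mass G d θ (insert v U) y : ℂ)) =
      -(comass G d θ U v : ℂ) := by
    simp [comass]
  rw [h2] at h1
  refine h1.congr' ?_
  filter_upwards [self_mem_nhdsWithin] with ε hε
  rw [inv_ratio G d hv (im_pos_of_pos θ hε).ne', mul_sub, Finset.mul_sum]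

theorem mass_nonneg (U : Set V) (v : V) : 0 ≤ mass G d θ U v := measureReal_nonneg

/-- The vertex `v` has a neighbour that is essential in `G - U - v`. -/
def PositiveIn (U : Set V) (v : V) : Prop := ∃ y, G.Adj v y ∧ EssentialIn G d θ (insert v U) y

theorem positiveIn_iff (U : Set V) (v : V) :
    PositiveIn G d θ U v ↔ comass G d θ U v ≠ 0 := by
  classical
  rw [comass, Ne, Finset.sum_eq_zero_iff_of_nonneg fun y _ => mass_nonneg G d θ _ y]
  push Not
  constructor
  · rintro ⟨y, h1, h2⟩
    have hy := h2.1
    rw [Set.mem_insert_iff, not_or] at hy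
    exact ⟨y, by simp [h1, hy.2], (essentialIn_iff G d θ h2.1).mp h2⟩
  · rintro ⟨y, h1, h2⟩
    rw [Finset.mem_filter, mem_nbrs] at h1
    refine ⟨y, h1.1, (essentialIn_iff G d θ ?_).mpr h2⟩
    rw [Set.mem_insert_iff, not_or]
    exact ⟨h1.1.ne', h1.2⟩

/-- The product of iε R and iε/R is (iε)², which tends to 0, so one of the two limits vanishes. -/
theorem EssentialIn.not_positiveIn {U : Set V} {v : V} (h : EssentialIn G d θ U v) :
    ¬ PositiveIn G d θ U v := by
  rw [positiveIn_iff, not_not]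
  have h1 := (tendsto_ratio G d θ U v).mul (tendsto_inv_ratio G d θ h.1)
  have h2 : Tendsto (fun ε : ℝ => Complex.I * (ε : ℂ) * (Complex.I * ε)) (𝓝[>] 0) (𝓝 0) := by
    simpa using tendsto_I_mul.mul tendsto_I_mul
  have h3 := tendsto_nhds_unique (h2.congr' ?_) h1
  · have hm := (essentialIn_iff G d θ h.1).mp h
    have : mass G d θ U v * comass G d θ U v = 0 := by
      have h4 : ((mass G d θ U v * comass G d θ U v : ℝ) : ℂ) = 0 := by
        push_cast
        linear_combination h3
      exact_mod_cast h4
    exact (mul_eq_zero.mp this).resolve_left hm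
  · filter_upwards [self_mem_nhdsWithin] with ε hε
    have := ratio_ne_zero G d h.1 (im_pos_of_pos θ hε).ne'
    field_simp

theorem mass_swap {U : Set V} {u v : V} (hu : u ∉ U) (hv : v ∉ U) (huv : u ≠ v) :
    mass G d θ U u * mass G d θ (insert u U) v = mass G d θ U v * mass G d θ (insert v U) u := by
  have h1 := (tendsto_ratio G d θ U u).mul (tendsto_ratio G d θ (insert u U) v)
  have h2 := (tendsto_ratio G d θ U v).mul (tendsto_ratio G d θ (insert v U) u)
  have h3 := tendsto_nhds_unique (h1.congr' ?_) h2
  · exact_mod_cast h3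
  · filter_upwards [self_mem_nhdsWithin] with ε hε
    have := ratio_swap G d (im_pos_of_pos θ hε) hu hv huv
    linear_combination (Complex.I * (ε : ℂ)) ^ 2 * this

theorem EssentialIn.swap {U : Set V} {u v : V} (hu : EssentialIn G d θ U u)
    (hv : EssentialIn G d θ (insert u U) v) :
    EssentialIn G d θ U v ∧ EssentialIn G d θ (insert v U) u := by
  have hv' := hv.1
  rw [Set.mem_insert_iff, not_or] at hv'
  have hu' : u ∉ insert v U := by
    rw [Set.mem_insert_iff, not_or]
    exact ⟨Ne.symm hv'.1, hu.1⟩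
  have h := mass_swap G d θ hu.1 hv'.2 (Ne.symm hv'.1)
  have h1 := (essentialIn_iff G d θ hu.1).mp hu
  have h2 := (essentialIn_iff G d θ hv.1).mp hv
  have h3 := mul_ne_zero h1 h2
  rw [h] at h3
  exact ⟨(essentialIn_iff G d θ hv'.2).mpr (left_ne_zero_of_mul h3),
    (essentialIn_iff G d θ hu').mpr (right_ne_zero_of_mul h3)⟩

theorem EssentialIn.insert_of_not {U : Set V} {x w : V} (hw : EssentialIn G d θ U w)
    (hx : ¬ EssentialIn G d θ U x) : EssentialIn G d θ (insert x U) w := by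
  rw [← Set.union_singleton]
  exact hw.union G d θ (by simpa using hx)

/-- Deleting a boundary vertex creates no new essential vertices. -/
theorem EssentialIn.of_insert_boundary {U : Set V} {x w v : V} (hxU : x ∉ U)
    (hx : ¬ EssentialIn G d θ U x) (hxw : G.Adj x w) (hw : EssentialIn G d θ U w)
    (hv : EssentialIn G d θ (insert x U) v) : EssentialIn G d θ U v := by
  by_contra hvn
  have hv' := hv.1
  rw [Set.mem_insert_iff, not_or] at hv'
  have hxv : x ∉ insert v U := by
    rw [Set.mem_insert_iff, not_or]
    exact ⟨Ne.symm hv'.1, hxU⟩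
  -- The neighbour w stays essential when the inessential x and v are deleted, so it makes x
  -- positive in both G - U and G - U - v.
  have p1 : PositiveIn G d θ U x := ⟨w, hxw, hw.insert_of_not G d θ hx⟩
  have p2 : PositiveIn G d θ (insert v U) x := by
    refine ⟨w, hxw, ?_⟩
    have := hw.union G d θ (B := {x, v}) (by rintro y (rfl | rfl) <;> assumption)
    rwa [Set.union_comm, Set.insert_union, Set.singleton_union] at this
  rw [positiveIn_iff] at p1 p2
  have hm := (essentialIn_iff G d θ hv.1).mp hv
  -- By symmetry R_U(v) = R_{U+x}(v) R_U(x) / R_{U+v}(x), and positivity of x on both sides makes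
  -- R_U(x) / R_{U+v}(x) tend to a nonzero limit.
  have h1 := ((tendsto_ratio G d θ (insert x U) v).mul (tendsto_inv_ratio G d θ hxv)).mul
    ((tendsto_inv_ratio G d θ hxU).inv₀ (by simpa using p1))
  have h2 := tendsto_nhds_unique (h1.congr' ?_) (tendsto_ratio G d θ U v)
  · have h3 : mass G d θ U v = 0 := by
      by_contra h
      exact hvn ((essentialIn_iff G d θ hv'.2).mpr h)
    rw [h3] at h2
    simp [hm, p1, p2] at h2
  · filter_upwards [self_mem_nhdsWithin] with ε hε
    have hz := im_pos_of_pos θ hε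
    have hs := ratio_swap G d hz hxU hv'.2 (Ne.symm hv'.1)
    have n1 := ratio_ne_zero G d hxU hz.ne'
    have n2 := ratio_ne_zero G d hxv hz.ne'
    have n3 := I_mul_ne_zero hε
    rw [mul_inv, inv_inv]
    field_simp
    linear_combination (ε : ℂ) * hs

/-- By symmetry 1/R_{U+v}(y) = (R_U(v) / R_U(y)) · 1/R_{U+y}(v), where the quotient in brackets
tends to a ratio of nonzero masses. -/
theorem PositiveIn.exchange {U : Set V} {y v : V} (hy : EssentialIn G d θ U y)
    (hv : EssentialIn G d θ U v) (hyv : y ≠ v) (h : PositiveIn G d θ (insert y U) v) :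
    PositiveIn G d θ (insert v U) y := by
  have hyU : y ∉ insert v U := by
    rw [Set.mem_insert_iff, not_or]
    exact ⟨hyv, hy.1⟩
  have hvU : v ∉ insert y U := by
    rw [Set.mem_insert_iff, not_or]
    exact ⟨hyv.symm, hv.1⟩
  rw [positiveIn_iff] at h ⊢
  have my := (essentialIn_iff G d θ hy.1).mp hy
  have mv := (essentialIn_iff G d θ hv.1).mp hv
  have h1 := ((tendsto_ratio G d θ U v).mul
    ((tendsto_ratio G d θ U y).inv₀ (by exact_mod_cast my))).mul (tendsto_inv_ratio G d θ hvU)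
  have h2 := tendsto_nhds_unique (h1.congr' ?_) (tendsto_inv_ratio G d θ hyU)
  · intro h3
    rw [h3] at h2
    simp [my, mv, h] at h2
  · filter_upwards [self_mem_nhdsWithin] with ε hε
    have hz := im_pos_of_pos θ hε
    have hs := ratio_swap G d hz hy.1 hv.1 hyv
    have n1 := ratio_ne_zero G d hy.1 hz.ne'
    have n2 := ratio_ne_zero G d hyU hz.ne'
    have n3 := ratio_ne_zero G d hvU hz.ne'
    have n4 := I_mul_ne_zero hε
    rw [mul_inv]
    field_simp
    linear_combination -(ε : ℂ) * hs

/-- Gallai's lemma: deleting an essential vertex makes its whole component of the graph induced on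
the essential vertices non-essential. -/
theorem not_essentialIn_insert_of_reachable {U S : Set V}
    (hS : ∀ v, v ∈ S ↔ EssentialIn G d θ U v) {a b : S} (h : (G.induce S).Reachable a b) :
    ¬ EssentialIn G d θ (insert b.1 U) a.1 := by
  obtain ⟨p⟩ := h
  induction p with
  | nil => exact fun h => h.1 (Set.mem_insert _ _)
  | @cons a a' b haa' p ih =>
    intro ha
    have hadj : G.Adj a.1 a'.1 := haa'
    have hb := (hS _).mp b.2
    have ha' := (hS _).mp a'.2
    by_cases hab : b = a'
    · subst hab
      exact hb.not_positiveIn G d θ ⟨a.1, hadj.symm, ha⟩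
    have hab' : b.1 ≠ a'.1 := fun h => hab (Subtype.ext h)
    -- If a were essential in G - U - b, its neighbour a', inessential there by induction, would be
    -- positive. The exchange makes b positive in G - U - a' through some y, and
    -- `EssentialIn.of_insert_boundary` restores a', so b would be both essential and positive in G
    -- - U.
    have hp : PositiveIn G d θ (insert b.1 U) a'.1 := ⟨a.1, hadj.symm, ha.insert_of_not G d θ ih⟩
    obtain ⟨y, hy1, hy2⟩ := hp.exchange G d θ hb ha' hab'
    rw [Set.insert_comm] at hy2
    have hy3 := EssentialIn.of_insert_boundary G d θ (U := insert b.1 U) (x := a'.1)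
      (by rw [Set.mem_insert_iff, not_or]; exact ⟨hab'.symm, ha'.1⟩) ih hadj.symm ha hy2
    exact hb.not_positiveIn G d θ ⟨y, hy1, hy3⟩

end Asymptotics

/-! ### Matching the boundary into distinct components: the proof of (b) -/

section Boundary

variable {V : Type u} (G : SimpleGraph V) (d : ℕ) [DegreeAtMost G d] (θ : ℝ)

/-- Each vertex of the list is essential after the deletion of `U` and of the vertices before it. -/
def EssentialList : Set V → List V → Prop
  | _, [] => True
  | U, v :: L => EssentialIn G d θ U v ∧ EssentialList (insert v U) L

/-- s is moved past the list one vertex at a time by `EssentialIn.swap`, and can then be dropped. -/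
theorem EssentialList.tail {U : Set V} {s : V} {L : List V} (hs : EssentialIn G d θ U s)
    (h : EssentialList G d θ (insert s U) L) : EssentialList G d θ U L := by
  induction L generalizing U s with
  | nil => trivial
  | cons t L ih =>
    obtain ⟨h1, h2⟩ := hs.swap G d θ h.1
    refine ⟨h1, ih h2 ?_⟩
    rw [Set.insert_comm]
    exact h.2

theorem EssentialList.forall_mem {U : Set V} {L : List V} (h : EssentialList G d θ U L) :
    ∀ v ∈ L, EssentialIn G d θ U v := by
  induction L with
  | nil => simp
  | cons s L ih =>
    intro v hv
    rcases List.mem_cons.mp hv with rfl | hv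
    · exact h.1
    · exact ih (EssentialList.tail G d θ h.1 h.2) v hv

/-- A later vertex is still essential after the deletion of an earlier one, which Gallai's lemma
forbids within one component. -/
theorem EssentialList.pairwise {U S : Set V} (hS : ∀ v, v ∈ S ↔ EssentialIn G d θ U v)
    {L : List V} (h : EssentialList G d θ U L) :
    L.Pairwise fun a b => ∀ (ha : a ∈ S) (hb : b ∈ S),
      ¬ (G.induce S).Reachable ⟨b, hb⟩ ⟨a, ha⟩ := by
  induction L with
  | nil => exact List.Pairwise.nil
  | cons s L ih =>
    rw [List.pairwise_cons]
    refine ⟨fun t ht hs ht' hr => ?_, ih (EssentialList.tail G d θ h.1 h.2)⟩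
    exact not_essentialIn_insert_of_reachable G d θ hS hr
      (EssentialList.forall_mem G d θ h.2 t ht)

theorem insert_union_setOf (U : Set V) (x : V) (X : List V) :
    insert x U ∪ {y | y ∈ X} = U ∪ {y | y ∈ x :: X} := by
  ext y
  simp only [Set.mem_union, Set.mem_insert_iff, Set.mem_ofPred_eq, List.mem_cons]
  tauto

/-- The limit is a product of limits from `tendsto_inv_ratio` and may be 0; it is nonzero only if
every deletion in turn is of positive type. -/
theorem exists_tendsto_inv_listRatio {X : List V} (hn : X.Nodup) {U : Set V}
    (hX : ∀ x ∈ X, x ∉ U) :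
    ∃ c, Tendsto (fun ε : ℝ => (Complex.I * ε) ^ X.length *
      (listRatio G d U X (θ + Complex.I * ε))⁻¹) (𝓝[>] 0) (𝓝 c) := by
  induction X generalizing U with
  | nil => exact ⟨1, by simp [listRatio]⟩
  | cons x X ih =>
    rw [List.nodup_cons] at hn
    obtain ⟨c, hc⟩ := ih hn.2 (U := insert x U) fun y hy => by
      rw [Set.mem_insert_iff, not_or]
      exact ⟨fun h => hn.1 (h ▸ hy), hX y (by simp [hy])⟩
    refine ⟨_, ((tendsto_inv_ratio G d θ (hX x (by simp))).mul hc).congr fun ε => ?_⟩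
    rw [List.length_cons, pow_succ, listRatio, mul_inv]
    ring

/-- If the deletion of the list `X` is as singular as possible, then `X` can be matched to a list
of successively essential vertices. -/
theorem exists_essentialList {X : List V} (hn : X.Nodup) {U : Set V} (hX : ∀ x ∈ X, x ∉ U) {c : ℂ}
    (hc : Tendsto (fun ε : ℝ => (Complex.I * ε) ^ X.length *
      (listRatio G d U X (θ + Complex.I * ε))⁻¹) (𝓝[>] 0) (𝓝 c)) (hc0 : c ≠ 0) :
    ∃ S, List.Forall₂ G.Adj X S ∧ EssentialList G d θ (U ∪ {x | x ∈ X}) S := by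
  induction X generalizing U c with
  | nil => exact ⟨[], List.Forall₂.nil, trivial⟩
  | cons x X ih =>
    rw [List.nodup_cons] at hn
    have hxU : x ∉ U := hX x (by simp)
    have hX' : ∀ y ∈ X, y ∉ insert x U := fun y hy => by
      rw [Set.mem_insert_iff, not_or]
      exact ⟨fun h => hn.1 (h ▸ hy), hX y (by simp [hy])⟩
    obtain ⟨c', hc'⟩ := exists_tendsto_inv_listRatio G d θ hn.2 hX'
    have h1 : c = -(comass G d θ U x : ℂ) * c' := by
      refine tendsto_nhds_unique hc
        (((tendsto_inv_ratio G d θ hxU).mul hc').congr fun ε => ?_)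
      rw [List.length_cons, pow_succ, listRatio, mul_inv]
      ring
    have hc'0 : c' ≠ 0 := by
      rintro rfl
      exact hc0 (by simpa using h1)
    have hpos : PositiveIn G d θ U x := by
      rw [positiveIn_iff]
      intro h
      exact hc0 (by simpa [h] using h1)
    obtain ⟨y, hxy, hy⟩ := hpos
    have hm := (essentialIn_iff G d θ hy.1).mp hy
    have h2 := (tendsto_ratio G d θ (insert x U) y).mul hc'
    have h20 : (mass G d θ (insert x U) y : ℂ) * c' ≠ 0 :=
      mul_ne_zero (by exact_mod_cast hm) hc'0
    -- If y were in X, deleting it first would cancel the ratio at y and leave a spare factor (iε)²,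
    -- so the nonzero limit of `h2` would be 0.
    by_cases hyX : y ∈ X
    · exfalso
      classical
      have hp := List.perm_cons_erase hyX
      have hne := hp.nodup_iff.mp hn.2
      rw [List.nodup_cons] at hne
      obtain ⟨e, he⟩ := exists_tendsto_inv_listRatio G d θ hne.2 (U := insert y (insert x U))
        fun w hw => by
          rw [Set.mem_insert_iff, not_or]
          exact ⟨fun h => hne.1 (h ▸ hw), hX' w (List.mem_of_mem_erase hw)⟩
      have h3 := (tendsto_I_mul.mul tendsto_I_mul).mul he
      rw [zero_mul, zero_mul] at h3
      refine h20 (tendsto_nhds_unique h2 (h3.congr' ?_))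
      filter_upwards [self_mem_nhdsWithin] with ε hε
      have hz := im_pos_of_pos θ hε
      have hr := ratio_ne_zero G d hy.1 hz.ne'
      rw [listRatio_perm G d hz hp hn.2 hX', listRatio, hp.length_eq, List.length_cons, pow_succ,
        mul_inv]
      field_simp
    · have hyn : (y :: X).Nodup := List.nodup_cons.mpr ⟨hyX, hn.2⟩
      have hyU : ∀ w ∈ y :: X, w ∉ insert x U := by
        intro w hw
        rcases List.mem_cons.mp hw with rfl | hw
        · exact hy.1
        · exact hX' w hw
      have hX'' : ∀ w ∈ X, w ∉ insert y (insert x U) := fun w hw => by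
        rw [Set.mem_insert_iff, not_or]
        exact ⟨fun h => hyX (h ▸ hw), hX' w hw⟩
      obtain ⟨e, he⟩ := exists_tendsto_inv_listRatio G d θ hn.2 hX''
      set W := insert x U ∪ {w | w ∈ X} with hW
      have hyW : y ∉ W := by
        rintro (h | h)
        · exact hy.1 h
        · exact hyX h
      -- Deleting y after X instead of before it gives the same product. The nonzero limit therefore
      -- factors as the mass of y in G - W times the limit e for X in G - U - x - y: y is essential
      -- in G - W, and the induction continues with y deleted.
      have h3 := (tendsto_ratio G d θ W y).mul he
      have h4 := tendsto_nhds_unique h2 (h3.congr' ?_)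
      · rw [h4] at h20
        have hyW' : EssentialIn G d θ W y :=
          (essentialIn_iff G d θ hyW).mpr (by exact_mod_cast left_ne_zero_of_mul h20)
        obtain ⟨S, hS1, hS2⟩ := ih hn.2 hX'' he (right_ne_zero_of_mul h20)
        refine ⟨y :: S, List.Forall₂.cons hxy hS1, ?_⟩
        rw [← insert_union_setOf, ← hW]
        refine ⟨hyW', ?_⟩
        rwa [Set.insert_union, ← hW] at hS2
      · filter_upwards [self_mem_nhdsWithin] with ε hε
        have hz := im_pos_of_pos θ hε
        have hp : (y :: X).Perm (X ++ [y]) := (List.perm_append_singleton y X).symm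
        have h5 := listRatio_perm G d hz hp hyn hyU
        rw [listRatio_append, listRatio, listRatio, listRatio, mul_one, ← hW] at h5
        have n1 := listRatio_ne_zero G d hn.2 hX' hz.ne'
        have n2 := listRatio_ne_zero G d hn.2 hX'' hz.ne'
        have h6 : ratio G d (insert x U) y (θ + Complex.I * ε) *
            (listRatio G d (insert x U) X (θ + Complex.I * ε))⁻¹ =
            ratio G d W y (θ + Complex.I * ε) *
            (listRatio G d (insert y (insert x U)) X (θ + Complex.I * ε))⁻¹ := by
          field_simp
          linear_combination h5
        linear_combination -(Complex.I * ε * (Complex.I * ε) ^ X.length) * h6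

/-- The boundary vertices of the set of essential vertices are independently removable. -/
theorem boundary_stable {X : List V} (hn : X.Nodup) {U : Set V}
    (hX : ∀ x ∈ X, x ∉ U ∧ ¬ EssentialIn G d θ U x ∧ ∃ w, G.Adj x w ∧ EssentialIn G d θ U w) :
    (∀ v, EssentialIn G d θ (U ∪ {x | x ∈ X}) v ↔ EssentialIn G d θ U v) ∧
    ∃ c, c ≠ 0 ∧ Tendsto (fun ε : ℝ => (Complex.I * ε) ^ X.length *
      (listRatio G d U X (θ + Complex.I * ε))⁻¹) (𝓝[>] 0) (𝓝 c) := by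
  induction X generalizing U with
  | nil => exact ⟨by simp, 1, one_ne_zero, by simp [listRatio]⟩
  | cons x X ih =>
    rw [List.nodup_cons] at hn
    obtain ⟨hxU, hx, w, hxw, hw⟩ := hX x (by simp)
    have hins : ∀ v, EssentialIn G d θ (insert x U) v ↔ EssentialIn G d θ U v := fun v =>
      ⟨fun h => EssentialIn.of_insert_boundary G d θ hxU hx hxw hw h, fun h => h.insert_of_not G d θ hx⟩
    obtain ⟨h1, c, hc0, hc⟩ := ih hn.2 (U := insert x U) fun y hy => by
      obtain ⟨h1, h2, h3⟩ := hX y (by simp [hy])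
      simp only [hins, Set.mem_insert_iff, not_or]
      exact ⟨⟨fun h => hn.1 (h ▸ hy), h1⟩, h2, h3⟩
    refine ⟨fun v => ?_, -(comass G d θ U x : ℂ) * c, ?_, ?_⟩
    · rw [← insert_union_setOf, h1, hins]
    · refine mul_ne_zero (neg_ne_zero.mpr ?_) hc0
      have : PositiveIn G d θ U x := ⟨w, hxw, (hins w).mpr hw⟩
      exact_mod_cast (positiveIn_iff G d θ U x).mp this
    · refine ((tendsto_inv_ratio G d θ hxU).mul hc).congr fun ε => ?_
      rw [List.length_cons, pow_succ, listRatio, mul_inv]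
      ring

/-- A list of boundary vertices, together with one essential vertex, can be matched to essential
vertices in distinct components of the graph induced on the essential vertices. -/
theorem exists_matching_of_boundary {X : List V} (hn : X.Nodup) {U : Set V}
    (hX : ∀ x ∈ X, x ∉ U ∧ ¬ EssentialIn G d θ U x ∧ ∃ w, G.Adj x w ∧ EssentialIn G d θ U w)
    {y : V} (hy : EssentialIn G d θ U y) :
    ∃ S, List.Forall₂ G.Adj X S ∧ EssentialList G d θ (U ∪ {x | x ∈ X}) (y :: S) := by
  obtain ⟨h1, c, hc0, hc⟩ := boundary_stable G d θ hn hX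
  have hyX : y ∉ X := fun h => (hX y h).2.1 hy
  have hy' := (h1 y).mpr hy
  have hXy : ∀ x ∈ X, x ∉ insert y U := fun x hx => by
    rw [Set.mem_insert_iff, not_or]
    exact ⟨fun h => hyX (h ▸ hx), (hX x hx).1⟩
  have m1 := (essentialIn_iff G d θ hy.1).mp hy
  have m2 := (essentialIn_iff G d θ hy'.1).mp hy'
  -- Deleting y before X rather than after it changes 1/R by the factor R_U(y) / R_{U ∪ X}(y), whose
  -- limit is nonzero because y is essential in both graphs. The matching is thus found with y
  -- already deleted, and y counts in addition to it.
  have h2 := (hc.mul (tendsto_ratio G d θ U y)).mul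
    ((tendsto_ratio G d θ (U ∪ {x | x ∈ X}) y).inv₀ (by exact_mod_cast m2))
  have h3 : Tendsto (fun ε : ℝ => (Complex.I * ε) ^ X.length *
      (listRatio G d (insert y U) X (θ + Complex.I * ε))⁻¹) (𝓝[>] 0)
      (𝓝 (c * mass G d θ U y * (mass G d θ (U ∪ {x | x ∈ X}) y : ℂ)⁻¹)) := by
    refine h2.congr' ?_
    filter_upwards [self_mem_nhdsWithin] with ε hε
    have hz := im_pos_of_pos θ hε
    have hp : (y :: X).Perm (X ++ [y]) := (List.perm_append_singleton y X).symm
    have h5 := listRatio_perm G d hz hp (List.nodup_cons.mpr ⟨hyX, hn⟩) (U := U) (by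
      intro w hw
      rcases List.mem_cons.mp hw with rfl | hw
      · exact hy.1
      · exact (hX w hw).1)
    rw [listRatio_append, listRatio, listRatio, listRatio, mul_one] at h5
    have n1 := listRatio_ne_zero G d hn (fun x hx => (hX x hx).1) hz.ne'
    have n2 := listRatio_ne_zero G d hn hXy hz.ne'
    have n3 := ratio_ne_zero G d hy'.1 hz.ne'
    have n4 : (ε : ℂ) ≠ 0 := Complex.ofReal_ne_zero.mpr (ne_of_gt hε)
    rw [mul_inv]
    field_simp
    linear_combination h5
  obtain ⟨S, hS1, hS2⟩ := exists_essentialList G d θ hn hXy h3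
    (mul_ne_zero (mul_ne_zero hc0 (by exact_mod_cast m1)) (inv_ne_zero (by exact_mod_cast m2)))
  refine ⟨S, hS1, hy', ?_⟩
  rwa [Set.insert_union] at hS2

theorem card_add_one_le_encard_adjacentComponents (X : Finset V) (hne : X.Nonempty)
    (hX : (X : Set V) ⊆ outerBoundary G (essentialSet G d θ)) :
    (X.card : ℕ∞) + 1 ≤ (adjacentComponents G (essentialSet G d θ) X).encard := by
  classical
  set D := essentialSet G d θ with hD
  have hDe : ∀ v, EssentialIn G d θ ∅ v ↔ v ∈ D := fun v => essentialIn_empty_iff G d θ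
  obtain ⟨x₁, hx₁⟩ := hne
  obtain ⟨-, y, hyD, hxy⟩ := hX hx₁
  have hb : ∀ x ∈ X.toList, x ∉ (∅ : Set V) ∧ ¬ EssentialIn G d θ ∅ x ∧
      ∃ w, G.Adj x w ∧ EssentialIn G d θ ∅ w := by
    intro x hx
    obtain ⟨h1, w, h2, h3⟩ := hX (Finset.mem_toList.mp hx)
    exact ⟨by simp, fun h => h1 ((hDe x).mp h), w, h3, (hDe w).mpr h2⟩
  obtain ⟨S, hS1, hS2⟩ := exists_matching_of_boundary G d θ X.nodup_toList hb ((hDe y).mpr hyD)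
  -- D is also the essential set of G - X, so a list successively essential in G - X lies in D and
  -- meets each component of G[D] at most once.
  have hst := (boundary_stable G d θ X.nodup_toList hb).1
  have hDs : ∀ v, v ∈ D ↔ EssentialIn G d θ (∅ ∪ {x | x ∈ X.toList}) v := fun v => by
    rw [hst, hDe]
  have hmem : ∀ v ∈ y :: S, v ∈ D := fun v hv =>
    (hDs v).mpr (EssentialList.forall_mem G d θ hS2 v hv)
  have hadj : ∀ v ∈ y :: S, ∃ x ∈ X, G.Adj x v := by
    intro v hv
    rcases List.mem_cons.mp hv with rfl | hv
    · exact ⟨x₁, hx₁, hxy⟩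
    · obtain ⟨i, hi, rfl⟩ := List.mem_iff_getElem.mp hv
      have hi' : i < X.toList.length := by rw [hS1.length_eq]; exact hi
      exact ⟨X.toList[i], Finset.mem_toList.mp (List.getElem_mem hi'), hS1.get hi' hi⟩
  let C : List (G.induce D).ConnectedComponent :=
    (y :: S).pmap (fun v hv => (G.induce D).connectedComponentMk ⟨v, hv⟩) hmem
  have hCn : C.Nodup := by
    refine List.Pairwise.pmap (EssentialList.pairwise G d θ hDs hS2) hmem ?_
    intro a ha b hb hab h
    exact hab ha hb (SimpleGraph.ConnectedComponent.exact h.symm)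
  have hsub : (C.toFinset : Set (G.induce D).ConnectedComponent) ⊆ adjacentComponents G D X := by
    intro c hc
    rw [List.coe_toFinset] at hc
    obtain ⟨v, hv, rfl⟩ := List.mem_pmap.mp hc
    obtain ⟨x, hx, hxv⟩ := hadj v hv
    exact ⟨x, hx, ⟨v, hmem v hv⟩, rfl, hxv⟩
  refine le_trans (le_of_eq ?_) (Set.encard_le_encard hsub)
  rw [Set.encard_coe_eq_coe_finsetCard, List.toFinset_card_of_nodup hCn, List.length_pmap,
    List.length_cons, ← hS1.length_eq, Finset.length_toList]
  push_cast
  rfl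

end Boundary

end MatchingMeasure

theorem theorem1p6 {V : Type*} (G : SimpleGraph V) (d : ℕ) [MatchingMeasure.DegreeAtMost G d]
    (θ : ℝ) :
    (∀ c : (G.induce (MatchingMeasure.essentialSet G d θ)).ConnectedComponent,
      MatchingMeasure.IsCritical c.toSimpleGraph d θ) ∧
    (∀ X : Finset V, X.Nonempty →
      (X : Set V) ⊆ MatchingMeasure.outerBoundary G (MatchingMeasure.essentialSet G d θ) →
      (X.card : ℕ∞) + 1 ≤
        (MatchingMeasure.adjacentComponents G (MatchingMeasure.essentialSet G d θ) X).encard) :=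
  ⟨MatchingMeasure.isCritical_component G d θ,
    MatchingMeasure.card_add_one_le_encard_adjacentComponents G d θ⟩
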